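/- Let $S$ be a real vector space with a nondegenerate symplectic form $\sigma$. A complex structure on $(S,\sigma)$ is a real-linear symplectomorphism $J:S\to S$ with $J^2=-I$ and $\sigma(f,Jf)>0$ for all $f\neq 0$. It makes $S$ a complex inner product space, with $(a+bi)f=af+bJf$ and $(f,g)_J=\sigma(f,Jg)+i\,\sigma(f,g)$ (conjugate-linear in the first variable). Let $\mathcal S_J$ be its Hilbert space completion, $\mathcal F(\mathcal S_J)=\mathbb C\oplus\bigoplus_{n\ge 1}P_+(\mathcal S_J^{\otimes n})$ the bosonic Fock space ($P_+$ is the projection onto the symmetric subspace), $\Omega_J=1\oplus0\oplus0\oplus\cdots$ the Fock vacuum vector, $N_J=0\oplus1\oplus2\oplus\cdots$ the total number operator, and $\Phi_J(f)=2^{-1/2}(a^*(f)+a(f))$, $f\in S$, the field operators, where $a^*(f)$ sends $\psi\in P_+(\mathcal S_J^{\otimes n})$ to $\sqrt{n+1}\,P_+(f\otimes\psi)$ and $a(f)$ is its adjoint. The Weyl algebra $\mathcal W$ over $(S,\sigma)$ is the C*-algebra generated by unitary Weyl operators $W(f)$, $f\in S$, with $W(f)W(g)=e^{-i\sigma(f,g)/2}W(f+g)$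 and $W(f)^*=W(-f)$. (Up to isomorphism it does not depend on the choice of the Weyl operators.) Each complex structure $J$ gives the Fock representation $\pi_J$ of $\mathcal W$ on $\mathcal F(\mathcal S_J)$ with $\pi_J(W(f))=\exp(i\Phi_J(f))$, and the Fock vacuum state $\omega_J(A)=\langle\Omega_J,\pi_J(A)\Omega_J\rangle$ of $\mathcal W$. A state (positive normalized linear functional) $\rho$ is dispersion-free on a bounded observable $X$ if $\rho(X^2)=\rho(X)^2$. A state $\omega$ of $\mathcal W$ predicts dispersion in $N_J$ if no state $\hat\rho$ of the von Neumann algebra $\pi_J(\mathcal W)''$ that extends $\omega$, i.e. with $\hat\rho(\pi_J(A))=\omega(A)$ for all $A\in\mathcal W$, is dispersion-free on all bounded functions of $N_J$. (By irreducibility of the Fock representation, $\pi_J(\mathcal W)''$ is the algebra $\mathbf B(\mathcal F(\mathcal S_J))$ of all bounded operators.) Proposition. If $J_1$ and $J_2$ are distinct complex structures on $(S,\sigma)$, then $\omega_{J_1}$ predicts dispersion in $N_{J_2}$, and $\omega_{J_2}$ predicts dispersion in $N_{J_1}$. -/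

import Mathlib

open scoped TensorProduct InnerProductSpace ComplexOrder ENNReal
open UniformSpace

noncomputable section

/-- The algebraic `n`-fold tensor power. -/
def AlgTensorPower (H : Type*) [NormedAddCommGroup H] [InnerProductSpace ℂ H] (n : ℕ) : Type _ :=
  ⨂[ℂ] _ : Fin n, H

namespace AlgTensorPower

variable {H : Type*} [NormedAddCommGroup H] [InnerProductSpace ℂ H] {n : ℕ}

instance : AddCommGroup (AlgTensorPower H n) := inferInstanceAs (AddCommGroup (⨂[ℂ] _ : Fin n, H))
instance : Module ℂ (AlgTensorPower H n) := inferInstanceAs (Module ℂ (⨂[ℂ] _ : Fin n, H))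

/-- The product vector `v 0 ⊗ ⋯ ⊗ v (n - 1)`. -/
def tprod : MultilinearMap ℂ (fun _ : Fin n => H) (AlgTensorPower H n) := PiTensorProduct.tprod ℂ

def lift {E : Type*} [AddCommGroup E] [Module ℂ E] (φ : MultilinearMap ℂ (fun _ : Fin n => H) E) :
    AlgTensorPower H n →ₗ[ℂ] E := PiTensorProduct.lift φ

@[simp] theorem lift_tprod {E : Type*} [AddCommGroup E] [Module ℂ E]
    (φ : MultilinearMap ℂ (fun _ : Fin n => H) E) (v : Fin n → H) : lift φ (tprod v) = φ v :=
  PiTensorProduct.lift.tprod v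

theorem induction {p : AlgTensorPower H n → Prop} (h : ∀ v, p (tprod v))
    (hs : ∀ (c : ℂ) x, p x → p (c • x)) (ha : ∀ x y, p x → p y → p (x + y)) (x) : p x :=
  PiTensorProduct.induction_on (motive := p) x (fun r v => hs r _ (h v)) ha

theorem exists_sum (x : AlgTensorPower H n) :
    ∃ (k : ℕ) (c : Fin k → ℂ) (v : Fin k → Fin n → H), x = ∑ i, c i • tprod (v i) := by
  have hx : x ∈ Submodule.span ℂ (Set.range (tprod : _ → AlgTensorPower H n)) := by
    induction x using induction with
    | h v => exact Submodule.subset_span ⟨v, rfl⟩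
    | hs c x hx => exact Submodule.smul_mem _ _ hx
    | ha x y hx hy => exact Submodule.add_mem _ hx hy
  obtain ⟨k, c, g, h⟩ := Submodule.mem_span_set'.1 hx
  choose v hv using fun i => (g i).2
  exact ⟨k, c, v, by simp [← h, hv]⟩

/-- The multilinear map `y ↦ ∏ i, ⟪x i, y i⟫`. -/
def pairMultilinear (x : Fin n → H) : MultilinearMap ℂ (fun _ : Fin n => H) ℂ :=
  (MultilinearMap.mkPiAlgebra ℂ (Fin n) ℂ).compLinearMap fun i => innerₛₗ ℂ (x i)

theorem pairMultilinear_apply (x y : Fin n → H) :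
    pairMultilinear x y = ∏ i, ⟪x i, y i⟫_ℂ := by simp [pairMultilinear]

theorem star_pairMultilinear (x y : Fin n → H) :
    star (pairMultilinear x y) = pairMultilinear y x := by
  simp [pairMultilinear_apply]

/-- The form with `form (⊗ x i) (⊗ y i) = ∏ i, ⟪y i, x i⟫`, linear in the first and
conjugate-linear in the second argument. -/
def form : AlgTensorPower H n →ₗ[ℂ] (AlgTensorPower H n →ₗ⋆[ℂ] ℂ) :=
  lift
    { toFun := fun x => (starLinearEquiv ℂ (A := ℂ)).toLinearMap.comp (lift (pairMultilinear x))
      map_update_add' := fun x i a b => by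
        ext y
        induction y using induction with
        | h v =>
          simp only [LinearMap.comp_apply, LinearEquiv.coe_coe, starLinearEquiv_apply, lift_tprod,
            star_pairMultilinear, LinearMap.add_apply, MultilinearMap.map_update_add]
        | hs c y hy => rw [map_smulₛₗ, hy, map_smulₛₗ]
        | ha y z hy hz => rw [map_add, hy, hz, map_add]
      map_update_smul' := fun x i a b => by
        ext y
        induction y using induction with
        | h v =>
          simp only [LinearMap.comp_apply, LinearEquiv.coe_coe, starLinearEquiv_apply, lift_tprod,
            star_pairMultilinear, LinearMap.smul_apply, MultilinearMap.map_update_smul]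
        | hs c y hy => rw [map_smulₛₗ, hy, map_smulₛₗ]
        | ha y z hy hz => rw [map_add, hy, hz, map_add] }

theorem form_tprod (x y : Fin n → H) : form (tprod x) (tprod y) = ∏ i, ⟪y i, x i⟫_ℂ := by
  rw [← pairMultilinear_apply, ← star_pairMultilinear]
  simp [form]

theorem star_form (x y : AlgTensorPower H n) : star (form x y) = form y x := by
  induction x using induction with
  | h v =>
    induction y using induction with
    | h w => simp [form_tprod]
    | hs c y hy => simp [← hy]
    | ha y z hy hz => simp [← hy, ← hz]
  | hs c x hx => simp [← hx]
  | ha x z hx hz => simp [← hx, ← hz]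

theorem posSemidef_prod {k : ℕ} (v : Fin k → Fin n → H) (s : Finset (Fin n)) :
    (Matrix.of fun a b => ∏ i ∈ s, ⟪v a i, v b i⟫_ℂ).PosSemidef := by
  induction s using Finset.induction_on with
  | empty =>
    have := Matrix.posSemidef_gram ℂ (fun _ : Fin k => (1 : ℂ))
    have h : (Matrix.of fun a b => ∏ i ∈ (∅ : Finset (Fin n)), ⟪v a i, v b i⟫_ℂ) =
        Matrix.gram ℂ fun _ : Fin k => (1 : ℂ) := by
      ext a b
      simp [Matrix.gram]
    exact h ▸ this
  | insert i s hi ih =>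
    have := (Matrix.posSemidef_gram ℂ (fun a => v a i)).hadamard ih
    have h : (Matrix.of fun a b => ∏ i ∈ insert i s, ⟪v a i, v b i⟫_ℂ) =
        (Matrix.gram ℂ fun a => v a i).hadamard
          (Matrix.of fun a b => ∏ i ∈ s, ⟪v a i, v b i⟫_ℂ) := by
      ext a b
      simp [Matrix.gram, Finset.prod_insert hi, Matrix.hadamard]
    exact h ▸ this

theorem form_self_nonneg (x : AlgTensorPower H n) : 0 ≤ form x x := by
  obtain ⟨k, c, v, rfl⟩ := exists_sum x
  have h := (posSemidef_prod v Finset.univ).dotProduct_mulVec_nonneg c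
  convert h using 1
  simp only [map_sum, LinearMap.sum_apply, map_smul, LinearMap.smul_apply, map_smulₛₗ, form_tprod,
    dotProduct, Matrix.mulVec, Finset.mul_sum, smul_eq_mul, Matrix.of_apply,
    Pi.star_apply, RCLike.star_def]
  refine Finset.sum_congr rfl fun a _ => Finset.sum_congr rfl fun b _ => ?_
  ring

instance : PreInnerProductSpace.Core ℂ (AlgTensorPower H n) where
  inner x y := form y x
  conj_inner_symm x y := star_form _ _
  re_inner_nonneg x := (Complex.nonneg_iff.1 (form_self_nonneg x)).1
  add_left x y z := by simp
  smul_left x y c := by simp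

instance : SeminormedAddCommGroup (AlgTensorPower H n) :=
  InnerProductSpace.Core.toSeminormedAddCommGroup (𝕜 := ℂ)
instance : InnerProductSpace ℂ (AlgTensorPower H n) :=
  InnerProductSpace.ofCore (𝕜 := ℂ) inferInstance

theorem inner_tprod (x y : Fin n → H) :
    ⟪(tprod x : AlgTensorPower H n), tprod y⟫_ℂ = ∏ i, ⟪x i, y i⟫_ℂ := form_tprod y x

theorem hom_ext {E : Type*} [AddCommGroup E] [Module ℂ E] {A B : AlgTensorPower H n →ₗ[ℂ] E}
    (h : ∀ v, A (tprod v) = B (tprod v)) : A = B := by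
  ext x
  induction x using induction with
  | h v => exact h v
  | hs c x hx => simp [hx]
  | ha x y hx hy => simp [hx, hy]

/-- Permutation of the tensor factors. -/
def perm (e : Equiv.Perm (Fin n)) : AlgTensorPower H n →ₗ[ℂ] AlgTensorPower H n :=
  lift (tprod.domDomCongr e)

@[simp] theorem perm_tprod (e : Equiv.Perm (Fin n)) (v : Fin n → H) :
    perm e (tprod v) = tprod (fun i => v (e i)) := by simp [perm]

/-- `x ↦ f ⊗ x`. -/
def cons : H →ₗ[ℂ] AlgTensorPower H n →ₗ[ℂ] AlgTensorPower H (n + 1) where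
  toFun f := lift (tprod.curryLeft f)
  map_add' f g := hom_ext fun v => by simp
  map_smul' c f := hom_ext fun v => by simp

@[simp] theorem cons_tprod (f : H) (v : Fin n → H) :
    cons f (tprod v) = tprod (Fin.cons f v) := by simp [cons]

theorem inner_cons (f g : H) (x y : AlgTensorPower H n) :
    ⟪cons f x, cons g y⟫_ℂ = ⟪f, g⟫_ℂ * ⟪x, y⟫_ℂ := by
  induction x using induction with
  | h v =>
    induction y using induction with
    | h w => simp [inner_tprod, Fin.prod_univ_succ]
    | hs c y hy => rw [map_smul, inner_smul_right, inner_smul_right, hy]; ring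
    | ha y z hy hz => rw [map_add, inner_add_right, inner_add_right, hy, hz]; ring
  | hs c x hx => rw [map_smul, inner_smul_left, inner_smul_left, hx]; ring
  | ha x z hx hz => rw [map_add, inner_add_left, inner_add_left, hx, hz]; ring

theorem inner_perm (e : Equiv.Perm (Fin n)) (x y : AlgTensorPower H n) :
    ⟪perm e x, perm e y⟫_ℂ = ⟪x, y⟫_ℂ := by
  induction x using induction with
  | h v =>
    induction y using induction with
    | h w => simp [inner_tprod, Equiv.prod_comp e fun i => ⟪v i, w i⟫_ℂ]
    | hs c y hy => rw [map_smul, inner_smul_right, inner_smul_right, hy]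
    | ha y z hy hz => rw [map_add, inner_add_right, inner_add_right, hy, hz]
  | hs c x hx => rw [map_smul, inner_smul_left, inner_smul_left, hx]
  | ha x z hx hz => rw [map_add, inner_add_left, inner_add_left, hx, hz]

theorem norm_perm (e : Equiv.Perm (Fin n)) (x : AlgTensorPower H n) : ‖perm e x‖ = ‖x‖ := by
  rw [norm_eq_sqrt_re_inner (𝕜 := ℂ), inner_perm, ← norm_eq_sqrt_re_inner]

theorem norm_cons (f : H) (x : AlgTensorPower H n) : ‖cons f x‖ = ‖f‖ * ‖x‖ := by
  rw [← sq_eq_sq₀ (by positivity) (by positivity), mul_pow]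
  have := inner_cons f f x x
  simp only [inner_self_eq_norm_sq_to_K] at this
  exact_mod_cast this

end AlgTensorPower

end

noncomputable section

/-- The `n`-fold Hilbert space tensor power: the completion of the algebraic one. -/
abbrev HilbertTensorPower (H : Type*) [NormedAddCommGroup H] [InnerProductSpace ℂ H] (n : ℕ) :
    Type _ :=
  Completion (AlgTensorPower H n)

namespace HilbertTensorPower

variable {H : Type*} [NormedAddCommGroup H] [InnerProductSpace ℂ H] {n : ℕ}

/-- The product vector `v 0 ⊗ ⋯ ⊗ v (n - 1)`. -/
def prodVec (v : Fin n → H) : HilbertTensorPower H n :=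
  ((AlgTensorPower.tprod v : AlgTensorPower H n) : Completion (AlgTensorPower H n))

theorem inner_prodVec (v w : Fin n → H) :
    ⟪prodVec v, prodVec w⟫_ℂ = ∏ i, ⟪v i, w i⟫_ℂ := by
  rw [prodVec, prodVec, Completion.inner_coe, AlgTensorPower.inner_tprod]

theorem clm_ext {E : Type*} [NormedAddCommGroup E] [NormedSpace ℂ E]
    {A B : HilbertTensorPower H n →L[ℂ] E} (h : ∀ v, A (prodVec v) = B (prodVec v)) : A = B := by
  ext x
  induction x using Completion.induction_on with
  | hp => exact isClosed_eq A.continuous B.continuous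
  | ih x =>
    have : A.toLinearMap.comp (Completion.toComplₗᵢ (𝕜 := ℂ)).toLinearMap =
        B.toLinearMap.comp (Completion.toComplₗᵢ (𝕜 := ℂ)).toLinearMap :=
      AlgTensorPower.hom_ext (fun v => h v)
    exact LinearMap.congr_fun this x

theorem ext_inner_prodVec {x y : HilbertTensorPower H n}
    (h : ∀ v, ⟪prodVec v, x⟫_ℂ = ⟪prodVec v, y⟫_ℂ) : x = y := by
  refine ext_inner_right ℂ fun z => ?_
  have : innerSL ℂ x = innerSL ℂ y := clm_ext fun v => by
    have := congrArg (starRingEnd ℂ) (h v)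
    simpa using this
  exact congrArg (fun L => L z) this

/-- Permutation of the tensor factors. -/
def perm (e : Equiv.Perm (Fin n)) : HilbertTensorPower H n →L[ℂ] HilbertTensorPower H n :=
  ((AlgTensorPower.perm e).mkContinuous 1
    fun x => by rw [AlgTensorPower.norm_perm, one_mul]).completion

@[simp] theorem perm_prodVec (e : Equiv.Perm (Fin n)) (v : Fin n → H) :
    perm e (prodVec v) = prodVec fun i => v (e i) := by
  rw [perm, prodVec, ContinuousLinearMap.completion_apply_coe, LinearMap.mkContinuous_apply,
    AlgTensorPower.perm_tprod, prodVec]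

/-- The bounded extension of `f₁ ⊗ ⋯ ⊗ fₙ ↦ f ⊗ f₁ ⊗ ⋯ ⊗ fₙ`. -/
def cons (f : H) : HilbertTensorPower H n →L[ℂ] HilbertTensorPower H (n + 1) :=
  ((AlgTensorPower.cons f).mkContinuous ‖f‖ fun x => (AlgTensorPower.norm_cons f x).le).completion

@[simp] theorem cons_prodVec (f : H) (v : Fin n → H) :
    cons f (prodVec v) = prodVec (Fin.cons f v : Fin (n + 1) → H) := by
  rw [cons, prodVec, ContinuousLinearMap.completion_apply_coe, LinearMap.mkContinuous_apply,
    AlgTensorPower.cons_tprod, prodVec]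

theorem inner_cons (f g : H) (x y : HilbertTensorPower H n) :
    ⟪cons f x, cons g y⟫_ℂ = ⟪f, g⟫_ℂ * ⟪x, y⟫_ℂ := by
  induction x, y using Completion.induction_on₂ with
  | hp => exact isClosed_eq (by fun_prop) (by fun_prop)
  | ih x y =>
    rw [cons, cons, ContinuousLinearMap.completion_apply_coe,
      ContinuousLinearMap.completion_apply_coe, Completion.inner_coe, Completion.inner_coe]
    exact AlgTensorPower.inner_cons f g x y

theorem norm_cons (f : H) (x : HilbertTensorPower H n) : ‖cons f x‖ = ‖f‖ * ‖x‖ := by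
  rw [← sq_eq_sq₀ (by positivity) (by positivity), mul_pow]
  have := inner_cons f f x x
  simp only [inner_self_eq_norm_sq_to_K] at this
  exact_mod_cast this

theorem cons_add (f g : H) (x : HilbertTensorPower H n) :
    cons (f + g) x = cons f x + cons g x := by
  have : cons (f + g) = (cons f + cons g : HilbertTensorPower H n →L[ℂ] _) :=
    clm_ext fun v => by
      simp only [cons_prodVec, add_apply]
      simp only [prodVec, ← AlgTensorPower.cons_tprod, map_add, LinearMap.add_apply,
        Completion.coe_add]
  rw [this, add_apply]

theorem cons_smul (c : ℂ) (f : H) (x : HilbertTensorPower H n) :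
    cons (c • f) x = c • cons f x := by
  have : cons (c • f) = (c • cons f : HilbertTensorPower H n →L[ℂ] _) :=
    clm_ext fun v => by
      simp only [cons_prodVec, smul_apply]
      simp only [prodVec, ← AlgTensorPower.cons_tprod, map_smul, LinearMap.smul_apply,
        Completion.coe_smul]
  rw [this, smul_apply]

/-- The bounded extension of `f₁ ⊗ ⋯ ⊗ fₙ₊₁ ↦ ⟪f, f₁⟫ f₂ ⊗ ⋯ ⊗ fₙ₊₁`, see
`contract_prodVec`. -/
def contract (f : H) : HilbertTensorPower H (n + 1) →L[ℂ] HilbertTensorPower H n :=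
  ContinuousLinearMap.adjoint (cons f)

theorem inner_contract_left (f : H) (x : HilbertTensorPower H (n + 1)) (y) :
    ⟪contract f x, y⟫_ℂ = ⟪x, cons f y⟫_ℂ := ContinuousLinearMap.adjoint_inner_left _ _ _

theorem inner_contract_right (f : H) (x : HilbertTensorPower H n) (y) :
    ⟪x, contract f y⟫_ℂ = ⟪cons f x, y⟫_ℂ := ContinuousLinearMap.adjoint_inner_right _ _ _

@[simp] theorem contract_prodVec (f : H) (v : Fin (n + 1) → H) :
    contract f (prodVec v) = ⟪f, v 0⟫_ℂ • prodVec (Fin.tail v) := by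
  refine ext_inner_prodVec fun w => ?_
  rw [inner_contract_right, cons_prodVec, inner_prodVec, inner_smul_right, inner_prodVec,
    Fin.prod_univ_succ]
  rfl

theorem contract_cons (f g : H) (x : HilbertTensorPower H n) :
    contract f (cons g x) = ⟪f, g⟫_ℂ • x := by
  refine ext_inner_left ℂ fun y => ?_
  rw [inner_contract_right, inner_cons, inner_smul_right]

theorem norm_contract_le (f : H) (x : HilbertTensorPower H (n + 1)) :
    ‖contract f x‖ ≤ ‖f‖ * ‖x‖ := by
  refine (ContinuousLinearMap.le_opNorm _ _).trans ?_
  gcongr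
  rw [contract, LinearIsometryEquiv.norm_map]
  exact ContinuousLinearMap.opNorm_le_bound _ (norm_nonneg _) fun y => (norm_cons f y).le

theorem perm_mul (e e' : Equiv.Perm (Fin n)) (x : HilbertTensorPower H n) :
    perm (e * e') x = perm e' (perm e x) := by
  have : perm (e * e') = ((perm e').comp (perm e) : HilbertTensorPower H n →L[ℂ] _) :=
    clm_ext fun v => by simp
  rw [this, ContinuousLinearMap.comp_apply]

theorem inner_perm (e : Equiv.Perm (Fin n)) (x y : HilbertTensorPower H n) :
    ⟪perm e x, perm e y⟫_ℂ = ⟪x, y⟫_ℂ := by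
  induction x, y using Completion.induction_on₂ with
  | hp => exact isClosed_eq (by fun_prop) (by fun_prop)
  | ih x y =>
    rw [perm, ContinuousLinearMap.completion_apply_coe,
      ContinuousLinearMap.completion_apply_coe, Completion.inner_coe, Completion.inner_coe]
    exact AlgTensorPower.inner_perm e x y

/-- The permutation of `Fin (n + 1)` fixing `0` and acting as `e` on the other indices. -/
def liftPerm (e : Equiv.Perm (Fin n)) : Equiv.Perm (Fin (n + 1)) :=
  Equiv.Perm.decomposeFin.symm (0, e)

@[simp] theorem liftPerm_zero (e : Equiv.Perm (Fin n)) : liftPerm e 0 = 0 := by simp [liftPerm]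

@[simp] theorem liftPerm_succ (e : Equiv.Perm (Fin n)) (i : Fin n) :
    liftPerm e i.succ = (e i).succ := by simp [liftPerm]

theorem exists_liftPerm (e : Equiv.Perm (Fin (n + 1))) (h : e 0 = 0) : ∃ e', liftPerm e' = e := by
  obtain ⟨⟨p, e'⟩, rfl⟩ := Equiv.Perm.decomposeFin.symm.surjective e
  have : p = 0 := by simpa using h
  exact ⟨e', by rw [this, liftPerm]⟩

theorem perm_cons (e : Equiv.Perm (Fin n)) (f : H) (x : HilbertTensorPower H n) :
    perm (liftPerm e) (cons f x) = cons f (perm e x) := by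
  have : (perm (liftPerm e)).comp (cons f) =
      ((cons f).comp (perm e) : HilbertTensorPower H n →L[ℂ] _) :=
    clm_ext fun v => by
      simp only [ContinuousLinearMap.comp_apply, cons_prodVec, perm_prodVec]
      congr 1
      funext i
      cases i using Fin.cases <;> simp
  exact congrArg (fun L => L x) this

theorem perm_contract (e : Equiv.Perm (Fin n)) (f : H) (x : HilbertTensorPower H (n + 1)) :
    contract f (perm (liftPerm e) x) = perm e (contract f x) := by
  have : (contract f).comp (perm (liftPerm e)) =
      ((perm e).comp (contract f) : HilbertTensorPower H (n + 1) →L[ℂ] _) :=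
    clm_ext fun v => by
      simp only [ContinuousLinearMap.comp_apply, contract_prodVec, perm_prodVec, liftPerm_zero,
        map_smul]
      have : Fin.tail (fun i => v (liftPerm e i)) = fun i => Fin.tail v (e i) :=
        funext fun i => by simp only [Fin.tail, liftPerm_succ]
      rw [this]
  exact congrArg (fun L => L x) this

theorem perm_swap_cons_cons (f g : H) (x : HilbertTensorPower H n) :
    perm (Equiv.swap 0 1) (cons f (cons g x)) = cons g (cons f x) := by
  have : (perm (Equiv.swap 0 1)).comp ((cons f).comp (cons g)) =
      ((cons g).comp (cons f) : HilbertTensorPower H n →L[ℂ] _) :=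
    clm_ext fun v => by
      simp only [ContinuousLinearMap.comp_apply, cons_prodVec, perm_prodVec]
      congr 1
      funext i
      refine Fin.cases (by simp) (fun i => Fin.cases (by simp) (fun i => ?_) i) i
      rw [Equiv.swap_apply_of_ne_of_ne (by simp) (by simp [Fin.ext_iff])]
      simp
  exact congrArg (fun L => L x) this

/-- Insertion of the tensor factor `g` at position `j`. -/
def insert (j : Fin (n + 1)) (g : H) : HilbertTensorPower H n →L[ℂ] HilbertTensorPower H (n + 1) :=
  (perm j.cycleRange).comp (cons g)

theorem insert_prodVec (j : Fin (n + 1)) (g : H) (v : Fin n → H) :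
    insert j g (prodVec v) = prodVec (j.insertNth g v) := by
  simp only [insert, ContinuousLinearMap.comp_apply, cons_prodVec, perm_prodVec]
  congr 1
  funext i
  rw [Fin.cons_apply_cycleRange]

theorem contract_insert_succ (j : Fin (n + 1)) (f g : H) (x : HilbertTensorPower H (n + 1)) :
    contract f (insert j.succ g x) = insert j g (contract f x) := by
  have : (contract f).comp (insert j.succ g) =
      ((insert j g).comp (contract f) : HilbertTensorPower H (n + 1) →L[ℂ] _) :=
    clm_ext fun v => by
      simp only [ContinuousLinearMap.comp_apply, insert_prodVec, contract_prodVec, map_smul]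
      have h0 : j.succ.insertNth (α := fun _ => H) g v 0 = v 0 := by
        have := Fin.insertNth_apply_succAbove (α := fun _ => H) j.succ g v 0
        rwa [Fin.succ_succAbove_zero] at this
      have h1 : Fin.tail (j.succ.insertNth (α := fun _ => H) g v) =
          j.insertNth (α := fun _ => H) g (Fin.tail v) := by
        rw [Fin.eq_insertNth_iff]
        refine ⟨Fin.insertNth_apply_same (α := fun _ => H) _ _ _, funext fun i => ?_⟩
        have := Fin.insertNth_apply_succAbove (α := fun _ => H) j.succ g v i.succ
        rwa [Fin.succ_succAbove_succ] at this
      rw [h0, h1]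
  exact congrArg (fun L => L x) this

theorem contract_insert_zero (f g : H) (x : HilbertTensorPower H n) :
    contract f (insert 0 g x) = ⟪f, g⟫_ℂ • x := by
  have : perm (1 : Equiv.Perm (Fin (n + 1))) = ContinuousLinearMap.id ℂ (HilbertTensorPower H _) :=
    clm_ext fun v => by simp
  rw [insert, Fin.cycleRange_zero, this, ContinuousLinearMap.id_comp, contract_cons]

end HilbertTensorPower

end

noncomputable section

/-- The symmetric subspace of the `n`-fold Hilbert space tensor power. -/
def symmetricSubspace (H : Type*) [NormedAddCommGroup H] [InnerProductSpace ℂ H] (n : ℕ) :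
    Submodule ℂ (HilbertTensorPower H n) where
  carrier := {x | ∀ e : Equiv.Perm (Fin n), HilbertTensorPower.perm e x = x}
  add_mem' hx hy e := by rw [map_add, hx e, hy e]
  zero_mem' e := map_zero _
  smul_mem' c x hx e := by rw [map_smul, hx e]

theorem isClosed_symmetricSubspace (H : Type*) [NormedAddCommGroup H] [InnerProductSpace ℂ H]
    (n : ℕ) : IsClosed (symmetricSubspace H n : Set (HilbertTensorPower H n)) := by
  have : (symmetricSubspace H n : Set (HilbertTensorPower H n)) =
      ⋂ e : Equiv.Perm (Fin n), {x | HilbertTensorPower.perm e x = x} := by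
    ext x
    simp [symmetricSubspace]
  rw [this]
  exact isClosed_iInter fun e =>
    isClosed_eq (HilbertTensorPower.perm e).continuous continuous_id

instance (H : Type*) [NormedAddCommGroup H] [InnerProductSpace ℂ H] (n : ℕ) :
    CompleteSpace (symmetricSubspace H n) :=
  (isClosed_symmetricSubspace H n).completeSpace_coe

/-- The `n`-particle space: the `n`-fold symmetric Hilbert space tensor power. -/
def SymPower (H : Type*) [NormedAddCommGroup H] [InnerProductSpace ℂ H] (n : ℕ) : Type _ :=
  symmetricSubspace H n

namespace SymPower

open HilbertTensorPower

variable {H : Type*} [NormedAddCommGroup H] [InnerProductSpace ℂ H] {n : ℕ}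

instance : NormedAddCommGroup (SymPower H n) :=
  inferInstanceAs (NormedAddCommGroup (symmetricSubspace H n))
instance : InnerProductSpace ℂ (SymPower H n) :=
  inferInstanceAs (InnerProductSpace ℂ (symmetricSubspace H n))
instance : CompleteSpace (SymPower H n) :=
  inferInstanceAs (CompleteSpace (symmetricSubspace H n))

/-- The inclusion of the symmetric subspace. -/
def incl : SymPower H n →ₗᵢ[ℂ] HilbertTensorPower H n := (symmetricSubspace H n).subtypeₗᵢ

/-- `P₊`, the orthogonal projection onto the symmetric subspace. -/
def proj : HilbertTensorPower H n →L[ℂ] SymPower H n :=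
  (symmetricSubspace H n).orthogonalProjectionOnto

theorem incl_injective : Function.Injective (incl : SymPower H n → HilbertTensorPower H n) :=
  incl.injective

theorem perm_incl (e : Equiv.Perm (Fin n)) (x : SymPower H n) : perm e (incl x) = incl x := x.2 e

theorem exists_incl {x : HilbertTensorPower H n} (hx : ∀ e, perm e x = x) :
    ∃ y : SymPower H n, incl y = x := ⟨⟨x, hx⟩, rfl⟩

theorem inner_incl (x y : SymPower H n) : ⟪incl x, incl y⟫_ℂ = ⟪x, y⟫_ℂ := incl.inner_map_map x y

theorem inner_proj_left (x : HilbertTensorPower H n) (y : SymPower H n) :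
    ⟪proj x, y⟫_ℂ = ⟪x, incl y⟫_ℂ :=
  Submodule.inner_orthogonalProjectionOnto_eq_of_mem_right (K := symmetricSubspace H n) y x

theorem norm_proj_le (x : HilbertTensorPower H n) : ‖proj x‖ ≤ ‖x‖ :=
  Submodule.norm_orthogonalProjectionOnto_apply_le _ _

theorem contract_incl_mem (f : H) (x : SymPower H (n + 1)) :
    contract f (incl x) ∈ symmetricSubspace H n := fun e => by
  rw [← perm_contract, perm_incl]

/-- The restriction of the contraction with `f` to the symmetric subspaces. -/
def symContract (f : H) : SymPower H (n + 1) →ₗ[ℂ] SymPower H n where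
  toFun x := ⟨contract f (incl x), contract_incl_mem f x⟩
  map_add' x y := incl_injective ((congrArg (contract f) (map_add incl x y)).trans (map_add _ _ _))
  map_smul' c x :=
    incl_injective ((congrArg (contract f) (map_smul incl c x)).trans (map_smul _ _ _))

theorem incl_symContract (f : H) (x : SymPower H (n + 1)) :
    incl (symContract f x) = contract f (incl x) := rfl

/-- The restriction of the creation operator for `f` to the `n`-particle space,
`√(n + 1) P₊ (f ⊗ ·)`. -/
def creation (f : H) (n : ℕ) : SymPower H n →ₗ[ℂ] SymPower H (n + 1) :=
  ((√(n + 1) : ℝ) : ℂ) • (proj.toLinearMap ∘ₗ (cons f).toLinearMap ∘ₗ incl.toLinearMap)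

/-- The restriction of the annihilation operator for `f` to the `(n + 1)`-particle space,
`√(n + 1)` times the contraction of the first tensor factor with `f`. -/
def annihilation (f : H) (n : ℕ) : SymPower H (n + 1) →ₗ[ℂ] SymPower H n :=
  ((√(n + 1) : ℝ) : ℂ) • symContract f

theorem creation_apply (f : H) (x : SymPower H n) :
    creation f n x = ((√(n + 1) : ℝ) : ℂ) • proj (cons f (incl x)) := rfl

theorem incl_annihilation (f : H) (x : SymPower H (n + 1)) :
    incl (annihilation f n x) = ((√(n + 1) : ℝ) : ℂ) • contract f (incl x) := by
  rw [annihilation, LinearMap.smul_apply, map_smul, incl_symContract]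

theorem inner_creation_left (f : H) (x : SymPower H n) (y : SymPower H (n + 1)) :
    ⟪creation f n x, y⟫_ℂ = ⟪x, annihilation f n y⟫_ℂ := by
  rw [creation_apply, inner_smul_left, inner_proj_left, ← inner_incl x, incl_annihilation,
    inner_smul_right, inner_contract_right, Complex.conj_ofReal]

theorem norm_annihilation_le (f : H) (x : SymPower H (n + 1)) :
    ‖annihilation f n x‖ ≤ √(n + 1) * ‖f‖ * ‖x‖ := by
  rw [← incl.norm_map (annihilation f n x), incl_annihilation, norm_smul, Complex.norm_real,
    Real.norm_of_nonneg (Real.sqrt_nonneg _), mul_assoc, ← incl.norm_map x]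
  gcongr
  exact norm_contract_le f _

theorem norm_creation_le (f : H) (x : SymPower H n) :
    ‖creation f n x‖ ≤ √(n + 1) * ‖f‖ * ‖x‖ := by
  rw [creation_apply, norm_smul, Complex.norm_real,
    Real.norm_of_nonneg (Real.sqrt_nonneg _), mul_assoc, ← incl.norm_map x]
  gcongr
  refine (norm_proj_le _).trans ?_
  rw [norm_cons]

theorem creation_add (f g : H) (x : SymPower H n) :
    creation (f + g) n x = creation f n x + creation g n x := by
  simp only [creation_apply, cons_add, map_add, smul_add]

theorem creation_smul (c : ℂ) (f : H) (x : SymPower H n) :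
    creation (c • f) n x = c • creation f n x := by
  simp only [creation_apply, cons_smul, map_smul, smul_comm c]

theorem annihilation_add (f g : H) (x : SymPower H (n + 1)) :
    annihilation (f + g) n x = annihilation f n x + annihilation g n x := by
  refine ext_inner_left ℂ fun y => ?_
  rw [inner_add_right]
  simp only [← inner_creation_left, creation_add, inner_add_left]

theorem annihilation_smul (c : ℂ) (f : H) (x : SymPower H (n + 1)) :
    annihilation (c • f) n x = starRingEnd ℂ c • annihilation f n x := by
  refine ext_inner_left ℂ fun y => ?_
  rw [inner_smul_right]
  simp only [← inner_creation_left, creation_smul, inner_smul_left]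

theorem annihilation_comm (f g : H) (x : SymPower H (n + 2)) :
    annihilation f n (annihilation g (n + 1) x) = annihilation g n (annihilation f (n + 1) x) := by
  have key : contract f (contract g (incl x)) = contract g (contract f (incl x)) := by
    refine ext_inner_left ℂ fun y => ?_
    rw [inner_contract_right, inner_contract_right, inner_contract_right, inner_contract_right,
      ← perm_swap_cons_cons f g, ← inner_perm (Equiv.swap 0 1) (cons f (cons g y)), perm_incl]
  apply incl_injective
  simp only [incl_annihilation, map_smul, key]

theorem creation_comm (f g : H) (x : SymPower H n) :
    creation f (n + 1) (creation g n x) = creation g (n + 1) (creation f n x) := by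
  refine ext_inner_right ℂ fun y => ?_
  simp only [inner_creation_left, annihilation_comm f g]

theorem proj_cons (g : H) (x : SymPower H n) :
    ((n : ℂ) + 1) • incl (proj (cons g (incl x))) =
      ∑ j, HilbertTensorPower.insert j g (incl x) := by
  obtain ⟨z, hz⟩ : ∃ z : SymPower H (n + 1),
      incl z = ∑ j, HilbertTensorPower.insert j g (incl x) := by
    refine exists_incl fun e => ?_
    rw [map_sum]
    have h : ∀ j : Fin (n + 1), perm e (HilbertTensorPower.insert j g (incl x)) =
        HilbertTensorPower.insert (e.symm j) g (incl x) := by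
      intro j
      obtain ⟨e', he'⟩ := exists_liftPerm
        (j.cycleRange * e * (e.symm j).cycleRange⁻¹) (by
          have : (e.symm j).cycleRange⁻¹ 0 = e.symm j := Fin.cycleRange_symm_zero _
          rw [Equiv.Perm.mul_apply, Equiv.Perm.mul_apply, this]
          simp)
      have h2 : j.cycleRange * e = liftPerm e' * (e.symm j).cycleRange := by
        rw [he']; group
      simp only [HilbertTensorPower.insert, ContinuousLinearMap.comp_apply]
      rw [← perm_mul, h2, perm_mul, perm_cons, perm_incl]
    simp only [h]
    exact Equiv.sum_comp e.symm fun j => HilbertTensorPower.insert j g (incl x)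
  rw [← hz, ← map_smul]
  congr 1
  refine ext_inner_right ℂ fun y => ?_
  rw [inner_smul_left, inner_proj_left, ← inner_incl z, hz, sum_inner]
  have h : ∀ j : Fin (n + 1), ⟪HilbertTensorPower.insert j g (incl x), incl y⟫_ℂ =
      ⟪cons g (incl x), incl y⟫_ℂ := by
    intro j
    rw [← inner_perm j.cycleRange (cons g (incl x)), perm_incl]
    rfl
  simp only [h]
  simp

theorem incl_annihilation_creation (f g : H) (x : SymPower H n) :
    incl (annihilation f n (creation g n x)) =
      ∑ j, contract f (HilbertTensorPower.insert j g (incl x)) := by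
  rw [incl_annihilation, creation_apply, ← map_sum, ← proj_cons, map_smul, map_smul,
    map_smul, smul_smul, ← Complex.ofReal_mul, Real.mul_self_sqrt (by positivity)]
  simp

theorem annihilation_creation_zero (f g : H) (x : SymPower H 0) :
    annihilation f 0 (creation g 0 x) = ⟪f, g⟫_ℂ • x := by
  apply incl_injective
  rw [incl_annihilation_creation]
  simp [contract_insert_zero]

theorem annihilation_creation_succ (f g : H) (x : SymPower H (n + 1)) :
    annihilation f (n + 1) (creation g (n + 1) x) =
      creation g n (annihilation f n x) + ⟪f, g⟫_ℂ • x := by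
  apply incl_injective
  have := proj_cons g (symContract f x)
  rw [incl_symContract] at this
  rw [incl_annihilation_creation, Fin.sum_univ_succ, contract_insert_zero]
  simp only [contract_insert_succ]
  rw [← this, add_comm (⟪f, g⟫_ℂ • incl x), map_add, map_smul, creation_apply, incl_annihilation, map_smul, map_smul,
    map_smul, map_smul, smul_smul, ← Complex.ofReal_mul, Real.mul_self_sqrt (by positivity)]
  simp

end SymPower
end

noncomputable section

/-- The bosonic Fock space over `H`: the Hilbert space direct sum of the `n`-particle spaces. -/
abbrev FockSpace (H : Type*) [NormedAddCommGroup H] [InnerProductSpace ℂ H] : Type _ :=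
  lp (fun n : ℕ => SymPower H n) 2

/-- The finite particle vectors: the elements of the Fock space with only finitely many nonzero
components. -/
def finiteParticle (H : Type*) [NormedAddCommGroup H] [InnerProductSpace ℂ H] :
    Submodule ℂ (FockSpace H) where
  carrier := {ψ | ∃ N, ∀ n, N ≤ n → ψ n = 0}
  add_mem' := by
    rintro φ ψ ⟨N, hN⟩ ⟨M, hM⟩
    refine ⟨max N M, fun n hn => ?_⟩
    rw [lp.coeFn_add, Pi.add_apply, hN n (le_of_max_le_left hn), hM n (le_of_max_le_right hn),
      add_zero]
  zero_mem' := ⟨0, fun n _ => rfl⟩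
  smul_mem' := by
    rintro c ψ ⟨N, hN⟩
    refine ⟨N, fun n hn => ?_⟩
    rw [lp.coeFn_smul, Pi.smul_apply, hN n hn, smul_zero]

/-- The finite particle vectors as a type. -/
def FiniteParticle (H : Type*) [NormedAddCommGroup H] [InnerProductSpace ℂ H] : Type _ :=
  finiteParticle H

namespace FiniteParticle

variable {H : Type*} [NormedAddCommGroup H] [InnerProductSpace ℂ H] {n : ℕ}

instance : AddCommGroup (FiniteParticle H) := inferInstanceAs (AddCommGroup (finiteParticle H))
instance : Module ℂ (FiniteParticle H) := inferInstanceAs (Module ℂ (finiteParticle H))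

/-- The inclusion of the finite particle vectors into the Fock space. -/
def toFock : FiniteParticle H →ₗ[ℂ] FockSpace H := (finiteParticle H).subtype

/-- The `n`-particle component. -/
def comp (n : ℕ) : FiniteParticle H →ₗ[ℂ] SymPower H n where
  toFun ψ := toFock ψ n
  map_add' φ ψ := by rw [map_add]; rfl
  map_smul' c ψ := by rw [map_smul]; rfl

theorem toFock_apply (ψ : FiniteParticle H) (n : ℕ) : toFock ψ n = comp n ψ := rfl

theorem exists_bound (ψ : FiniteParticle H) : ∃ N, ∀ n, N ≤ n → comp n ψ = 0 := ψ.2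

@[ext] theorem ext {φ ψ : FiniteParticle H} (h : ∀ n, comp n φ = comp n ψ) : φ = ψ :=
  Subtype.ext (lp.ext (funext h))

/-- The finite particle vector with given components, only finitely many of which are nonzero. -/
def mk (ψ : ∀ n, SymPower H n) (h : ∃ N, ∀ n, N ≤ n → ψ n = 0) : FiniteParticle H :=
  ⟨⟨ψ, (memℓp_zero (by
      obtain ⟨N, hN⟩ := h
      refine (Set.finite_lt_nat N).subset fun n hn => ?_
      by_contra hlt
      exact hn (hN n (not_lt.1 hlt)))).of_exponent_ge zero_le⟩, h⟩

@[simp] theorem comp_mk (ψ : ∀ n, SymPower H n) (h) (n : ℕ) : comp n (mk ψ h) = ψ n := rfl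

theorem denseRange_toFock : DenseRange (toFock : FiniteParticle H → FockSpace H) := by
  intro ψ
  have h := lp.hasSum_single (E := fun n => SymPower H n) (p := 2) (by simp) ψ
  refine mem_closure_of_tendsto h (Filter.Eventually.of_forall fun s => ?_)
  have : ∀ i, lp.single 2 i (ψ i) ∈ finiteParticle H := fun i =>
    ⟨i + 1, fun n hn => lp.single_apply_ne _ _ _ (by omega)⟩
  exact ⟨⟨_, Submodule.sum_mem _ fun i _ => this i⟩, rfl⟩

/-- The components of `a*(f) ψ`. -/
def creationSeq (f : H) (ψ : FiniteParticle H) : ∀ n, SymPower H n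
  | 0 => 0
  | n + 1 => SymPower.creation f n (comp n ψ)

/-- The creation operator `a*(f)` on finite particle vectors. -/
def creation (f : H) : FiniteParticle H →ₗ[ℂ] FiniteParticle H where
  toFun ψ := mk (creationSeq f ψ) (by
    obtain ⟨N, hN⟩ := exists_bound ψ
    refine ⟨N + 1, fun n hn => ?_⟩
    obtain ⟨n, rfl⟩ : ∃ m, n = m + 1 := ⟨n - 1, by omega⟩
    rw [creationSeq, hN n (by omega), map_zero])
  map_add' φ ψ := by
    ext n
    cases n with
    | zero => simp [creationSeq]
    | succ n => simp [creationSeq]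
  map_smul' c ψ := by
    ext n
    cases n with
    | zero => simp [creationSeq]
    | succ n => simp [creationSeq]

/-- The annihilation operator `a(f)` on finite particle vectors. -/
def annihilation (f : H) : FiniteParticle H →ₗ[ℂ] FiniteParticle H where
  toFun ψ := mk (fun n => SymPower.annihilation f n (comp (n + 1) ψ)) (by
    obtain ⟨N, hN⟩ := exists_bound ψ
    exact ⟨N, fun n hn => by rw [hN (n + 1) (by omega), map_zero]⟩)
  map_add' φ ψ := by
    ext n
    simp
  map_smul' c ψ := by
    ext n
    simp

@[simp] theorem comp_zero_creation (f : H) (ψ : FiniteParticle H) :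
    comp 0 (creation f ψ) = 0 := rfl

@[simp] theorem comp_succ_creation (f : H) (ψ : FiniteParticle H) (n : ℕ) :
    comp (n + 1) (creation f ψ) = SymPower.creation f n (comp n ψ) := rfl

@[simp] theorem comp_annihilation (f : H) (ψ : FiniteParticle H) (n : ℕ) :
    comp n (annihilation f ψ) = SymPower.annihilation f n (comp (n + 1) ψ) := rfl

/-- The field operator `Φ(f) = 2^(-1/2) (a*(f) + a(f))` on finite particle vectors. -/
def field (f : H) : FiniteParticle H →ₗ[ℂ] FiniteParticle H :=
  (((√2)⁻¹ : ℝ) : ℂ) • (creation f + annihilation f)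

theorem annihilation_creation (f g : H) (ψ : FiniteParticle H) :
    annihilation f (creation g ψ) = creation g (annihilation f ψ) + ⟪f, g⟫_ℂ • ψ := by
  refine ext fun n => ?_
  rw [comp_annihilation, comp_succ_creation, map_add, map_smul]
  cases n with
  | zero =>
    rw [comp_zero_creation, SymPower.annihilation_creation_zero]
    exact (zero_add _).symm
  | succ n => rw [comp_succ_creation, comp_annihilation, SymPower.annihilation_creation_succ]

theorem annihilation_comm (f g : H) (ψ : FiniteParticle H) :
    annihilation f (annihilation g ψ) = annihilation g (annihilation f ψ) := by
  refine ext fun n => ?_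
  simp only [comp_annihilation]
  exact SymPower.annihilation_comm f g _

theorem creation_comm (f g : H) (ψ : FiniteParticle H) :
    creation f (creation g ψ) = creation g (creation f ψ) := by
  refine ext fun n => ?_
  match n with
  | 0 => rw [comp_zero_creation, comp_zero_creation]
  | 1 => rw [comp_succ_creation, comp_succ_creation, comp_zero_creation, comp_zero_creation,
      map_zero, map_zero]
  | n + 2 =>
    simp only [comp_succ_creation]
    exact SymPower.creation_comm f g _

theorem creation_add (f g : H) : creation (f + g) = creation f + creation g := by
  refine LinearMap.ext fun ψ => ext fun n => ?_
  rw [LinearMap.add_apply, map_add]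
  cases n with
  | zero => simp only [comp_zero_creation, add_zero]
  | succ n => simp only [comp_succ_creation, SymPower.creation_add]

theorem creation_smul (c : ℂ) (f : H) : creation (c • f) = c • creation f := by
  refine LinearMap.ext fun ψ => ext fun n => ?_
  rw [LinearMap.smul_apply, map_smul]
  cases n with
  | zero => simp only [comp_zero_creation, smul_zero]
  | succ n => simp only [comp_succ_creation, SymPower.creation_smul]

theorem annihilation_add (f g : H) : annihilation (f + g) = annihilation f + annihilation g := by
  refine LinearMap.ext fun ψ => ext fun n => ?_
  rw [LinearMap.add_apply, map_add]
  simp only [comp_annihilation, SymPower.annihilation_add]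

theorem annihilation_smul (c : ℂ) (f : H) :
    annihilation (c • f) = starRingEnd ℂ c • annihilation f := by
  refine LinearMap.ext fun ψ => ext fun n => ?_
  rw [LinearMap.smul_apply, map_smul]
  simp only [comp_annihilation, SymPower.annihilation_smul]

theorem field_comm (f g : H) (ψ : FiniteParticle H) :
    field f (field g ψ) = field g (field f ψ) + (Complex.I * (⟪f, g⟫_ℂ).im) • ψ := by
  have h : (((√2)⁻¹ : ℝ) : ℂ) * (((√2)⁻¹ : ℝ) : ℂ) = 1 / 2 := by
    rw [← Complex.ofReal_mul, ← mul_inv, Real.mul_self_sqrt (by norm_num)]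
    norm_num
  have h3 : (Complex.I * (⟪f, g⟫_ℂ).im) = (1 / 2 : ℂ) * (⟪f, g⟫_ℂ - ⟪g, f⟫_ℂ) := by
    rw [← inner_conj_symm g f, Complex.sub_conj]
    push_cast; ring
  simp only [field]
  rw [← h] at h3
  generalize (((√2)⁻¹ : ℝ) : ℂ) = c at h3 ⊢
  simp only [LinearMap.smul_apply, LinearMap.add_apply, map_smul, map_add, h3,
    annihilation_creation, annihilation_comm f g, creation_comm f g]
  module

theorem field_add (f g : H) : field (f + g) = field f + field g := by
  rw [field, field, field, creation_add, annihilation_add]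
  module

theorem field_smul (t : ℝ) (f : H) : field ((t : ℂ) • f) = (t : ℂ) • field f := by
  rw [field, field, creation_smul, annihilation_smul, Complex.conj_ofReal]
  module

theorem inner_eq_sum {φ ψ : FiniteParticle H} {N : ℕ} (h : ∀ n, N ≤ n → comp n ψ = 0) :
    ⟪toFock φ, toFock ψ⟫_ℂ = ∑ n ∈ Finset.range N, ⟪comp n φ, comp n ψ⟫_ℂ := by
  rw [lp.inner_eq_tsum]
  refine tsum_eq_sum fun n hn => ?_
  rw [toFock_apply, toFock_apply, h n (by simpa using hn), inner_zero_right]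

theorem inner_creation_left (f : H) (φ ψ : FiniteParticle H) :
    ⟪toFock (creation f φ), toFock ψ⟫_ℂ = ⟪toFock φ, toFock (annihilation f ψ)⟫_ℂ := by
  obtain ⟨N, hN⟩ := exists_bound ψ
  rw [inner_eq_sum (N := N + 1) fun n hn => hN n (by omega), inner_eq_sum (N := N) fun n hn => by
    rw [comp_annihilation, hN _ (by omega), map_zero], Finset.sum_range_succ']
  rw [comp_zero_creation, inner_zero_left, add_zero]
  refine Finset.sum_congr rfl fun n _ => ?_
  rw [comp_succ_creation, comp_annihilation, SymPower.inner_creation_left]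

theorem inner_field_left (f : H) (φ ψ : FiniteParticle H) :
    ⟪toFock (field f φ), toFock ψ⟫_ℂ = ⟪toFock φ, toFock (field f ψ)⟫_ℂ := by
  have h : ⟪toFock (annihilation f φ), toFock ψ⟫_ℂ = ⟪toFock φ, toFock (creation f ψ)⟫_ℂ := by
    rw [← inner_conj_symm, ← inner_creation_left, inner_conj_symm]
  simp only [field, LinearMap.smul_apply, LinearMap.add_apply, map_smul, map_add, inner_smul_left,
    inner_smul_right, inner_add_left, inner_add_right, inner_creation_left, h, Complex.conj_ofReal]
  ring

theorem norm_comp_field_le (f : H) (ψ : FiniteParticle H) {N : ℕ} {C : ℝ}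
    (hN : ∀ n, N ≤ n → comp n ψ = 0) (hC : ∀ n, ‖comp n ψ‖ ≤ C) (n : ℕ) :
    ‖comp n (field f ψ)‖ ≤ 2 * √N * ‖f‖ * C := by
  have hC0 : 0 ≤ C := (norm_nonneg _).trans (hC 0)
  have hcr : ‖comp n (creation f ψ)‖ ≤ √N * ‖f‖ * C := by
    cases n with
    | zero => rw [comp_zero_creation, norm_zero]; positivity
    | succ n =>
      rw [comp_succ_creation]
      by_cases hn : N ≤ n
      · rw [hN n hn, map_zero, norm_zero]; positivity
      · refine (SymPower.norm_creation_le _ _).trans ?_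
        gcongr
        · exact_mod_cast (by omega : n + 1 ≤ N)
        · exact hC n
  have han : ‖comp n (annihilation f ψ)‖ ≤ √N * ‖f‖ * C := by
    rw [comp_annihilation]
    by_cases hn : N ≤ n + 1
    · rw [hN _ hn, map_zero, norm_zero]; positivity
    · refine (SymPower.norm_annihilation_le _ _).trans ?_
      gcongr
      · exact_mod_cast (by omega : n + 1 ≤ N)
      · exact hC _
  have h2 : ‖(((√2)⁻¹ : ℝ) : ℂ)‖ ≤ 1 := by
    rw [Complex.norm_real, Real.norm_of_nonneg (by positivity)]
    exact inv_le_one_of_one_le₀ (by simp)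
  rw [field, LinearMap.smul_apply, LinearMap.add_apply, map_smul, map_add, norm_smul]
  calc _ ≤ 1 * (√N * ‖f‖ * C + √N * ‖f‖ * C) := by
        gcongr
        exact (norm_add_le _ _).trans (add_le_add hcr han)
    _ = _ := by ring

theorem bounds_field_pow (f : H) (ψ : FiniteParticle H) {N : ℕ} {C : ℝ}
    (hN : ∀ n, N ≤ n → comp n ψ = 0) (hC : ∀ n, ‖comp n ψ‖ ≤ C) (k : ℕ) :
    (∀ n, N + k ≤ n → comp n ((field f ^ k) ψ) = 0) ∧
      ∀ n, ‖comp n ((field f ^ k) ψ)‖ ≤ (∏ i ∈ Finset.range k, (2 * √(N + i) * ‖f‖)) * C := by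
  induction k with
  | zero => simpa using ⟨hN, hC⟩
  | succ k ih =>
    rw [pow_succ']
    refine ⟨fun n hn => ?_, fun n => ?_⟩
    · have h1 : comp (n + 1) ((field f ^ k) ψ) = 0 := ih.1 _ (by omega)
      obtain ⟨n, rfl⟩ : ∃ m, n = m + 1 := ⟨n - 1, by omega⟩
      have h2 : comp n ((field f ^ k) ψ) = 0 := ih.1 _ (by omega)
      rw [Module.End.mul_apply, field, LinearMap.smul_apply, LinearMap.add_apply, map_smul, map_add,
        comp_succ_creation, comp_annihilation, ← field, h1, h2, map_zero, map_zero, add_zero,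
        smul_zero]
    · have := norm_comp_field_le f _ ih.1 ih.2 n
      rw [Finset.prod_range_succ]
      refine this.trans (le_of_eq ?_)
      push_cast
      ring

theorem norm_toFock_le (ψ : FiniteParticle H) {N : ℕ} {C : ℝ}
    (hN : ∀ n, N ≤ n → comp n ψ = 0) (hC : ∀ n, ‖comp n ψ‖ ≤ C) : ‖toFock ψ‖ ≤ N * C := by
  have h : ‖toFock ψ‖ ^ 2 ≤ N * C ^ 2 := by
    have h1 : ((‖toFock ψ‖ ^ 2 : ℝ) : ℂ) = ((∑ n ∈ Finset.range N, ‖comp n ψ‖ ^ 2 : ℝ) : ℂ) := by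
      have := inner_eq_sum (φ := ψ) hN
      simp only [inner_self_eq_norm_sq_to_K] at this
      exact_mod_cast this
    rw [Complex.ofReal_inj.1 h1]
    refine (Finset.sum_le_sum fun n _ => pow_le_pow_left₀ (norm_nonneg _) (hC n) 2).trans ?_
    simp
  have hC0 : 0 ≤ C := (norm_nonneg _).trans (hC 0)
  refine le_of_sq_le_sq ?_ (by positivity)
  refine h.trans ?_
  rw [mul_pow]
  gcongr
  exact_mod_cast Nat.le_self_pow two_ne_zero N

theorem summable_aux (N : ℕ) {F : ℝ} (hF : 0 ≤ F) (C : ℝ) :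
    Summable fun k : ℕ => ((N + k : ℕ) : ℝ) *
      ((∏ i ∈ Finset.range k, (2 * √((N : ℝ) + i) * F)) * C) / k.factorial := by
  refine summable_of_ratio_norm_eventually_le (r := 1 / 2) (by norm_num) ?_
  obtain ⟨K, hK⟩ := exists_nat_ge (64 * F ^ 2 * (N + 1))
  filter_upwards [Filter.eventually_ge_atTop (max K 1)] with k hk
  have hk1 : (1 : ℝ) ≤ k := by exact_mod_cast le_of_max_le_right hk
  have hkK : 64 * F ^ 2 * (N + 1) ≤ k :=
    hK.trans (by exact_mod_cast le_of_max_le_left hk)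
  have hs : 8 * F * √((N : ℝ) + k) ≤ k + 1 := by
    refine le_of_sq_le_sq ?_ (by positivity)
    rw [mul_pow, Real.sq_sqrt (by positivity)]
    have hN : (0 : ℝ) ≤ N := Nat.cast_nonneg N
    nlinarith [mul_nonneg (sq_nonneg F) hN, mul_le_mul_of_nonneg_right hkK (by positivity : (0 : ℝ) ≤ k + 1),
      mul_nonneg (mul_nonneg (sq_nonneg F) hN) (by positivity : (0 : ℝ) ≤ k)]
  have hN0 : (0 : ℝ) ≤ N := Nat.cast_nonneg N
  rw [Finset.prod_range_succ, Nat.factorial_succ]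
  set P := ∏ i ∈ Finset.range k, (2 * √((N : ℝ) + i) * F)
  have hP : 0 ≤ P := Finset.prod_nonneg fun i _ => by positivity
  push_cast
  rw [norm_div, norm_div, norm_mul, norm_mul (P * _) C, norm_mul P, norm_mul ((N : ℝ) + k),
    norm_mul P C]
  simp only [Real.norm_eq_abs]
  rw [abs_of_nonneg (by positivity : (0 : ℝ) ≤ N + (k + 1)),
    abs_of_nonneg (by positivity : (0 : ℝ) ≤ N + k), abs_of_nonneg hP,
    abs_of_nonneg (by positivity : (0 : ℝ) ≤ 2 * √((N : ℝ) + k) * F),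
    abs_of_nonneg (by positivity : (0 : ℝ) ≤ (k + 1) * (k.factorial : ℝ)),
    abs_of_nonneg (by positivity : (0 : ℝ) ≤ (k.factorial : ℝ)),
    div_le_iff₀ (by positivity)]
  have e : 1 / 2 * ((N + k) * (P * |C|) / k.factorial) * ((k + 1) * (k.factorial : ℝ)) =
      (1 / 2 * (N + k) * (k + 1)) * (P * |C|) := by
    field_simp
  rw [e]
  have h3 : ((N : ℝ) + (k + 1)) * (2 * √((N : ℝ) + k) * F) ≤ 1 / 2 * (N + k) * (k + 1) := by
    have : (N : ℝ) + (k + 1) ≤ 2 * (N + k) := by linarith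
    calc _ ≤ 2 * ((N : ℝ) + k) * (2 * √((N : ℝ) + k) * F) := by gcongr
      _ = 1 / 2 * (N + k) * (8 * F * √((N : ℝ) + k)) := by ring
      _ ≤ _ := by gcongr
  calc _ = ((N : ℝ) + (k + 1)) * (2 * √((N : ℝ) + k) * F) * (P * |C|) := by ring
    _ ≤ _ := by gcongr

theorem summable_norm_field_pow (f : H) (ψ : FiniteParticle H) :
    Summable fun k : ℕ => ‖toFock ((field f ^ k) ψ)‖ / k.factorial := by
  obtain ⟨N, hN⟩ := exists_bound ψ
  have hC : ∀ n, ‖comp n ψ‖ ≤ ‖toFock ψ‖ :=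
    fun n => lp.norm_apply_le_norm (by simp) (toFock ψ) n
  refine Summable.of_nonneg_of_le (fun k => by positivity) (fun k => ?_)
    (summable_aux N (norm_nonneg f) ‖toFock ψ‖)
  gcongr
  have := bounds_field_pow f ψ hN hC k
  exact norm_toFock_le _ this.1 this.2

end FiniteParticle
end

noncomputable section

namespace WeylSeries

open Finset

variable {R : Type*} [Ring R] [Algebra ℂ R]

/-- The terms of degree `k` in `exp X * exp Y`. -/
def expProd (X Y : R) (k : ℕ) : R :=
  ∑ p ∈ antidiagonal k, ((p.1.factorial : ℂ)⁻¹ * (p.2.factorial : ℂ)⁻¹) • (X ^ p.1 * Y ^ p.2)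

/-- The Taylor coefficients of `t ↦ exp (t ^ 2 * c)`. -/
def gaussCoeff (c : ℂ) : ℕ → ℂ
  | 0 => 1
  | 1 => 0
  | n + 2 => 2 * c / (n + 2) * gaussCoeff c n

/-- The terms of degree `k` in `exp Z * exp c`, where `c` has degree `2`. -/
def expGauss (Z : R) (c : ℂ) (k : ℕ) : R :=
  ∑ p ∈ antidiagonal k, ((p.1.factorial : ℂ)⁻¹ * gaussCoeff c p.2) • Z ^ p.1

theorem pow_mul_comm' {X Y : R} {c : ℂ} (h : X * Y = Y * X + algebraMap ℂ R (2 * c)) (m : ℕ) :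
    X ^ (m + 1) * Y = Y * X ^ (m + 1) + ((m + 1 : ℂ) * (2 * c)) • X ^ m := by
  induction m with
  | zero => simp [h, Algebra.algebraMap_eq_smul_one]
  | succ m ih =>
    rw [pow_succ', mul_assoc, ih, mul_add, ← mul_assoc, h, mul_smul_comm, ← pow_succ', add_mul,
      mul_assoc Y X, ← pow_succ', Algebra.algebraMap_eq_smul_one, smul_one_mul]
    push_cast
    module

theorem fac_succ (n : ℕ) : ((n : ℂ) + 1) * ((n + 1).factorial : ℂ)⁻¹ = (n.factorial : ℂ)⁻¹ := by
  have : (n : ℂ) + 1 ≠ 0 := by exact_mod_cast n.succ_ne_zero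
  rw [Nat.factorial_succ]
  push_cast
  field_simp

theorem expProd_succ (X Y : R) (k : ℕ) :
    ((k : ℂ) + 1) • expProd X Y (k + 1) = X * expProd X Y k + expProd X Y k * Y := by
  have h1 : ((k : ℂ) + 1) • expProd X Y (k + 1) =
      ∑ p ∈ antidiagonal (k + 1), (((p.1 : ℂ) * ((p.1.factorial : ℂ)⁻¹ * (p.2.factorial : ℂ)⁻¹)) •
        (X ^ p.1 * Y ^ p.2)) +
      ∑ p ∈ antidiagonal (k + 1), (((p.2 : ℂ) * ((p.1.factorial : ℂ)⁻¹ * (p.2.factorial : ℂ)⁻¹)) •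
        (X ^ p.1 * Y ^ p.2)) := by
    rw [expProd, smul_sum, ← sum_add_distrib]
    refine sum_congr rfl fun p hp => ?_
    have : ((k : ℂ) + 1) = p.1 + p.2 := by
      have := mem_antidiagonal.1 hp
      exact_mod_cast this.symm
    rw [this]
    module
  rw [h1, Nat.sum_antidiagonal_succ, Nat.sum_antidiagonal_succ']
  simp only [Nat.cast_zero, zero_mul, zero_smul, zero_add, Nat.cast_add, Nat.cast_one]
  rw [expProd, mul_sum, sum_mul]
  congr 1
  · refine sum_congr rfl fun p _ => ?_
    rw [← mul_assoc, fac_succ, mul_smul_comm, ← mul_assoc, ← pow_succ']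
  · refine sum_congr rfl fun p _ => ?_
    rw [mul_left_comm, fac_succ, smul_mul_assoc, mul_assoc, ← pow_succ]

theorem expProd_mul_zero (X Y : R) : expProd X Y 0 * Y = Y * expProd X Y 0 := by
  simp [expProd]

theorem expProd_mul_succ {X Y : R} {c : ℂ} (h : X * Y = Y * X + algebraMap ℂ R (2 * c)) (k : ℕ) :
    expProd X Y (k + 1) * Y = Y * expProd X Y (k + 1) + (2 * c) • expProd X Y k := by
  rw [expProd, expProd, sum_mul, mul_sum, smul_sum, Nat.sum_antidiagonal_succ,
    Nat.sum_antidiagonal_succ, add_assoc, ← sum_add_distrib]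
  congr 1
  · simp only [pow_zero, one_mul, smul_mul_assoc, mul_smul_comm, ← pow_succ, ← pow_succ']
  · refine sum_congr rfl fun p _ => ?_
    have hY : X ^ (p.1 + 1) * Y ^ p.2 * Y =
        Y * (X ^ (p.1 + 1) * Y ^ p.2) + ((p.1 + 1 : ℂ) * (2 * c)) • (X ^ p.1 * Y ^ p.2) := by
      rw [mul_assoc, ← pow_succ, pow_succ' Y, ← mul_assoc, pow_mul_comm' h, add_mul, smul_mul_assoc,
        mul_assoc Y]
    simp only [smul_mul_assoc, mul_smul_comm]
    rw [hY, smul_add, smul_smul, smul_smul, ← fac_succ p.1]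
    congr 2
    ring

theorem expGauss_succ_zero (Z : R) (c : ℂ) : expGauss Z c 1 = Z := by
  simp [expGauss, Nat.sum_antidiagonal_succ, gaussCoeff]

theorem expGauss_succ_succ (Z : R) (c : ℂ) (k : ℕ) :
    ((k : ℂ) + 2) • expGauss Z c (k + 2) = Z * expGauss Z c (k + 1) + (2 * c) • expGauss Z c k := by
  have h1 : ((k : ℂ) + 2) • expGauss Z c (k + 2) =
      ∑ p ∈ antidiagonal (k + 2), (((p.1 : ℂ) * ((p.1.factorial : ℂ)⁻¹ * gaussCoeff c p.2)) •
        Z ^ p.1) +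
      ∑ p ∈ antidiagonal (k + 2), (((p.2 : ℂ) * ((p.1.factorial : ℂ)⁻¹ * gaussCoeff c p.2)) •
        Z ^ p.1) := by
    rw [expGauss, smul_sum, ← sum_add_distrib]
    refine sum_congr rfl fun p hp => ?_
    have : ((k : ℂ) + 2) = p.1 + p.2 := by
      have := mem_antidiagonal.1 hp
      exact_mod_cast this.symm
    rw [this]
    module
  rw [h1]
  congr 1
  · rw [Nat.sum_antidiagonal_succ]
    simp only [Nat.cast_zero, zero_mul, zero_smul, zero_add, Nat.cast_add, Nat.cast_one]
    rw [expGauss, mul_sum]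
    refine sum_congr rfl fun p _ => ?_
    rw [← mul_assoc, fac_succ, mul_smul_comm, ← pow_succ']
  · rw [Nat.sum_antidiagonal_succ', Nat.sum_antidiagonal_succ']
    simp only [Nat.cast_zero, zero_mul, zero_smul, Nat.cast_add, Nat.cast_one, zero_add,
      gaussCoeff, mul_zero]
    rw [expGauss, smul_sum]
    refine sum_congr rfl fun p _ => ?_
    rw [smul_smul]
    have : (p.2 : ℂ) + 2 ≠ 0 := by exact_mod_cast (p.2 + 1).succ_ne_zero
    congr 1
    field_simp
    ring

theorem expProd_eq_expGauss {X Y : R} {c : ℂ} (h : X * Y = Y * X + algebraMap ℂ R (2 * c)) :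
    ∀ k, expProd X Y k = expGauss (X + Y) c k := by
  have h1 : expProd X Y 1 = X + Y := by
    simp [expProd, Nat.sum_antidiagonal_succ, add_comm]
  have key : ∀ k, expProd X Y k = expGauss (X + Y) c k ∧
      expProd X Y (k + 1) = expGauss (X + Y) c (k + 1) := by
    intro k
    induction k with
    | zero => exact ⟨by simp [expProd, expGauss, gaussCoeff], by rw [h1, expGauss_succ_zero]⟩
    | succ k ih =>
      refine ⟨ih.2, ?_⟩
      have hk : (k : ℂ) + 2 ≠ 0 := by exact_mod_cast (k + 1).succ_ne_zero
      refine smul_right_injective R hk ?_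
      have h2 := expProd_succ X Y (k + 1)
      rw [expProd_mul_succ h, ih.1, ih.2, ← add_assoc, ← add_mul] at h2
      simp only
      rw [expGauss_succ_succ, ← h2]
      push_cast
      congr 1
      ring
  exact fun k => (key k).1

theorem gaussCoeff_even (c : ℂ) (l : ℕ) : gaussCoeff c (2 * l) = c ^ l / l.factorial := by
  induction l with
  | zero => simp [gaussCoeff]
  | succ l ih =>
    rw [show 2 * (l + 1) = 2 * l + 2 by ring, gaussCoeff, ih, Nat.factorial_succ]
    have : (l : ℂ) + 1 ≠ 0 := by exact_mod_cast l.succ_ne_zero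
    have : (l.factorial : ℂ) ≠ 0 := by exact_mod_cast l.factorial_ne_zero
    push_cast
    field_simp
    ring

theorem gaussCoeff_odd (c : ℂ) (l : ℕ) : gaussCoeff c (2 * l + 1) = 0 := by
  induction l with
  | zero => rfl
  | succ l ih => rw [show 2 * (l + 1) + 1 = (2 * l + 1) + 2 by ring, gaussCoeff, ih, mul_zero]

theorem hasSum_gaussCoeff (c : ℂ) : HasSum (gaussCoeff c) (Complex.exp c) := by
  have h1 : HasSum (fun l => gaussCoeff c (2 * l)) (Complex.exp c) := by
    simp only [gaussCoeff_even]
    rw [Complex.exp_eq_exp_ℂ]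
    exact NormedSpace.expSeries_div_hasSum_exp c
  have h2 : HasSum (fun l => gaussCoeff c (2 * l + 1)) 0 := by
    simp only [gaussCoeff_odd]
    exact hasSum_zero
  simpa using h1.even_add_odd h2

theorem inner_tsum_tsum {F : Type*} [NormedAddCommGroup F] [InnerProductSpace ℂ F]
    [CompleteSpace F] {u v : ℕ → F} (hu : Summable fun n => ‖u n‖) (hv : Summable fun n => ‖v n‖) :
    ⟪∑' n, u n, ∑' n, v n⟫_ℂ = ∑' k, ∑ p ∈ antidiagonal k, ⟪u p.1, v p.2⟫_ℂ := by
  have hs : Summable fun p : ℕ × ℕ => ⟪u p.1, v p.2⟫_ℂ :=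
    Summable.of_norm_bounded (hu.mul_of_nonneg hv (fun _ => norm_nonneg _) fun _ => norm_nonneg _)
      fun p => norm_inner_le_norm _ _
  have h1 : ⟪∑' n, u n, ∑' n, v n⟫_ℂ = ∑' p : ℕ × ℕ, ⟪u p.1, v p.2⟫_ℂ := by
    rw [hs.tsum_prod]
    have h2 : ∀ m, ∑' n, ⟪u m, v n⟫_ℂ = ⟪u m, ∑' n, v n⟫_ℂ := fun m =>
      ((innerSL ℂ (u m)).map_tsum hv.of_norm).symm
    simp only [h2]
    have h3 := (innerSLFlip ℂ (∑' n, v n)).map_tsum hu.of_norm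
    simpa using h3
  rw [h1, ← HasAntidiagonal.sigmaAntidiagonalEquivProd.tsum_eq (_ : ℕ × ℕ → ℂ)]
  refine ((HasAntidiagonal.sigmaAntidiagonalEquivProd.summable_iff.2 hs).tsum_sigma'
      (fun n => (hasSum_fintype _).summable)).trans (tsum_congr fun k => ?_)
  rw [tsum_fintype]
  exact Finset.sum_finset_coe (fun p : ℕ × ℕ => ⟪u p.1, v p.2⟫_ℂ) (antidiagonal k)

end WeylSeries

namespace FiniteParticle

variable {H : Type*} [NormedAddCommGroup H] [InnerProductSpace ℂ H] {n : ℕ}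

/-- The `k`-th term `(i Φ(f)) ^ k ψ / k!` of the exponential series of `i Φ(f)`. -/
def expTerm (f : H) (k : ℕ) : FiniteParticle H →ₗ[ℂ] FockSpace H :=
  (k.factorial : ℂ)⁻¹ • toFock ∘ₗ (Complex.I • field f) ^ k

theorem expTerm_apply (f : H) (k : ℕ) (ψ : FiniteParticle H) :
    expTerm f k ψ = (k.factorial : ℂ)⁻¹ • toFock (((Complex.I • field f) ^ k) ψ) := rfl

theorem summable_norm_expTerm (f : H) (ψ : FiniteParticle H) :
    Summable fun k => ‖expTerm f k ψ‖ := by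
  refine (summable_norm_field_pow f ψ).congr fun k => ?_
  rw [expTerm_apply, smul_pow, LinearMap.smul_apply, map_smul, norm_smul, norm_smul]
  simp [div_eq_inv_mul]

/-- `exp (i Φ(f)) ψ` for finite particle vectors `ψ`, given by the exponential series. -/
def expField (f : H) : FiniteParticle H →ₗ[ℂ] FockSpace H where
  toFun ψ := ∑' k, expTerm f k ψ
  map_add' φ ψ := by
    simp only [map_add]
    exact (summable_norm_expTerm f φ).of_norm.tsum_add (summable_norm_expTerm f ψ).of_norm
  map_smul' c ψ := by
    simp only [map_smul]
    exact (summable_norm_expTerm f ψ).of_norm.tsum_const_smul c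

theorem hasSum_expField (f : H) (ψ : FiniteParticle H) :
    HasSum (fun k => expTerm f k ψ) (expField f ψ) :=
  (summable_norm_expTerm f ψ).of_norm.hasSum

theorem inner_pow_left (f : H) (m : ℕ) (φ ψ : FiniteParticle H) :
    ⟪toFock (((Complex.I • field f) ^ m) φ), toFock ψ⟫_ℂ =
      ⟪toFock φ, toFock (((-Complex.I • field f) ^ m) ψ)⟫_ℂ := by
  induction m generalizing ψ with
  | zero => rfl
  | succ m ih =>
    rw [pow_succ', pow_succ, Module.End.mul_apply, Module.End.mul_apply, ← ih]
    simp only [LinearMap.smul_apply, map_smul, inner_smul_left, inner_smul_right, inner_field_left]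
    simp

theorem inner_expField (f g : H) (φ ψ : FiniteParticle H) :
    ⟪expField f φ, expField g ψ⟫_ℂ =
      Complex.exp (Complex.I * (⟪f, g⟫_ℂ).im / 2) * ⟪toFock φ, expField (g - f) ψ⟫_ℂ := by
  set c : ℂ := Complex.I * (⟪f, g⟫_ℂ).im / 2 with hc
  have hcomm : (-Complex.I • field f) * (Complex.I • field g) =
      (Complex.I • field g) * (-Complex.I • field f) +
        algebraMap ℂ (Module.End ℂ (FiniteParticle H)) (2 * c) := by
    refine LinearMap.ext fun ψ => ?_
    simp only [Module.End.mul_apply, LinearMap.smul_apply, LinearMap.add_apply, map_smul,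
      field_comm f g, Module.algebraMap_end_apply, hc]
    rw [smul_add, smul_add, smul_smul, smul_smul, smul_smul, smul_smul, neg_mul, mul_neg,
      ← mul_assoc, neg_mul, Complex.I_mul_I, neg_neg]
    congr 2
    ring
  have hsum : -Complex.I • field f + Complex.I • field g = Complex.I • field (g - f) := by
    have h := field_smul (-1) f
    rw [sub_eq_add_neg, field_add, show -f = (((-1 : ℝ) : ℂ)) • f by simp, h]
    push_cast
    module
  have h1 := WeylSeries.inner_tsum_tsum (summable_norm_expTerm f φ) (summable_norm_expTerm g ψ)
  have h2 : ⟪toFock φ, expField (g - f) ψ⟫_ℂ = ∑' k, ⟪toFock φ, expTerm (g - f) k ψ⟫_ℂ :=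
    (innerSL ℂ (toFock φ)).map_tsum (summable_norm_expTerm (g - f) ψ).of_norm
  have h3 : Summable fun k => ‖⟪toFock φ, expTerm (g - f) k ψ⟫_ℂ‖ :=
    Summable.of_nonneg_of_le (fun _ => norm_nonneg _) (fun k => norm_inner_le_norm _ _)
      ((summable_norm_expTerm (g - f) ψ).mul_left _)
  have hG := WeylSeries.hasSum_gaussCoeff c
  rw [mul_comm, h2, ← hG.tsum_eq,
    tsum_mul_tsum_eq_tsum_sum_antidiagonal_of_summable_norm h3 hG.summable.norm]
  refine h1.trans (tsum_congr fun k => ?_)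
  have key := congrArg (fun L => ⟪toFock φ, toFock (L ψ)⟫_ℂ)
    (WeylSeries.expProd_eq_expGauss hcomm k)
  simp only [hsum, WeylSeries.expProd, WeylSeries.expGauss, LinearMap.sum_apply, map_sum,
    inner_sum, LinearMap.smul_apply, map_smul, inner_smul_right] at key
  convert key using 2 with p _ p _
  · rw [expTerm_apply, expTerm_apply, inner_smul_left, inner_smul_right, inner_pow_left,
      Module.End.mul_apply]
    simp
    ring
  · rw [expTerm_apply, inner_smul_right]
    ring

theorem expField_zero (ψ : FiniteParticle H) : expField (0 : H) ψ = toFock ψ := by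
  have h0 : field (0 : H) = 0 := by
    have := field_smul 0 (0 : H)
    simpa using this
  refine (hasSum_expField 0 ψ).unique ?_
  have : ∀ k, k ≠ 0 → expTerm (0 : H) k ψ = 0 := fun k hk => by
    rw [expTerm_apply, h0, smul_zero, zero_pow hk, LinearMap.zero_apply, map_zero, smul_zero]
  have h := hasSum_single 0 this
  rwa [expTerm_apply, Nat.factorial_zero, Nat.cast_one, inv_one, one_smul, pow_zero] at h

theorem norm_expField (f : H) (ψ : FiniteParticle H) : ‖expField f ψ‖ = ‖toFock ψ‖ := by
  have h := inner_expField f f ψ ψ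
  have h0 : (⟪f, f⟫_ℂ).im = 0 := inner_self_im (𝕜 := ℂ) f
  rw [sub_self, expField_zero, h0, Complex.ofReal_zero, mul_zero, zero_div,
    Complex.exp_zero, one_mul] at h
  rw [norm_eq_sqrt_re_inner (𝕜 := ℂ), h, ← norm_eq_sqrt_re_inner]

end FiniteParticle

namespace FockSpace

open FiniteParticle

variable {H : Type*} [NormedAddCommGroup H] [InnerProductSpace ℂ H]

/-- The operator `exp (i Φ(f))` on the Fock space: the bounded extension of the exponential series
on the dense subspace of finite particle vectors, see `weyl_toFock`. -/
def weyl (f : H) : FockSpace H →L[ℂ] FockSpace H := (expField f).extendOfNorm toFock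

theorem weyl_toFock (f : H) (ψ : FiniteParticle H) : weyl f (toFock ψ) = expField f ψ :=
  LinearMap.extendOfNorm_eq denseRange_toFock ⟨1, fun ψ => by rw [norm_expField, one_mul]⟩ ψ

theorem inner_weyl (f g : H) (φ ψ : FockSpace H) :
    ⟪weyl f φ, weyl g ψ⟫_ℂ =
      Complex.exp (Complex.I * (⟪f, g⟫_ℂ).im / 2) * ⟪φ, weyl (g - f) ψ⟫_ℂ := by
  refine denseRange_toFock.induction_on₂
    (p := fun φ ψ => ⟪weyl f φ, weyl g ψ⟫_ℂ =
      Complex.exp (Complex.I * (⟪f, g⟫_ℂ).im / 2) * ⟪φ, weyl (g - f) ψ⟫_ℂ)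
    (isClosed_eq (by fun_prop) (by fun_prop)) (fun φ ψ => ?_) φ ψ
  simp only [weyl_toFock, inner_expField]

theorem weyl_zero : weyl (0 : H) = 1 := by
  refine ContinuousLinearMap.ext fun φ => ?_
  refine denseRange_toFock.induction_on φ (isClosed_eq (by fun_prop) (by fun_prop)) fun φ => ?_
  rw [weyl_toFock, expField_zero]
  rfl

theorem adjoint_weyl (f : H) : star (weyl f) = weyl (-f) := by
  rw [ContinuousLinearMap.star_eq_adjoint]
  refine (ContinuousLinearMap.eq_adjoint_iff _ _).2 (fun φ ψ => ?_) |>.symm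
  have h := inner_weyl f 0 ψ φ
  rw [weyl_zero, zero_sub, inner_zero_right, Complex.zero_im, Complex.ofReal_zero, mul_zero,
    zero_div, Complex.exp_zero, one_mul] at h
  have h2 := congrArg (starRingEnd ℂ) h
  rw [inner_conj_symm, inner_conj_symm] at h2
  exact h2.symm

theorem weyl_mul (f g : H) :
    weyl f * weyl g = Complex.exp (-(Complex.I * (⟪f, g⟫_ℂ).im) / 2) • weyl (f + g) := by
  refine ContinuousLinearMap.ext fun ψ => ext_inner_left ℂ fun φ => ?_
  have h := inner_weyl (-f) g φ ψ
  rw [← adjoint_weyl, ContinuousLinearMap.star_eq_adjoint, ContinuousLinearMap.adjoint_inner_left]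
    at h
  rw [mul_apply_eq_comp, h, smul_apply, inner_smul_right, inner_neg_left,
    Complex.neg_im, sub_neg_eq_add, add_comm g f]
  congr 2
  push_cast
  ring

end FockSpace
end

noncomputable section

namespace FockSpace

variable {H : Type*} [NormedAddCommGroup H] [InnerProductSpace ℂ H]

/-- The unit vector of the `0`-particle space, which is a copy of `ℂ`. -/
def vacuumComp (H : Type*) [NormedAddCommGroup H] [InnerProductSpace ℂ H] : SymPower H 0 :=
  SymPower.proj (HilbertTensorPower.prodVec Fin.elim0)

/-- The Fock vacuum `Ω = 1 ⊕ 0 ⊕ 0 ⊕ ⋯`. -/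
def vacuum (H : Type*) [NormedAddCommGroup H] [InnerProductSpace ℂ H] : FockSpace H :=
  lp.single 2 0 (vacuumComp H)

theorem incl_vacuumComp :
    SymPower.incl (vacuumComp H) = HilbertTensorPower.prodVec Fin.elim0 := by
  have h : ∀ e : Equiv.Perm (Fin 0),
      HilbertTensorPower.perm e (HilbertTensorPower.prodVec (Fin.elim0 : Fin 0 → H)) =
        HilbertTensorPower.prodVec Fin.elim0 := fun e => by
    rw [HilbertTensorPower.perm_prodVec]
    exact congrArg _ (Subsingleton.elim _ _)
  obtain ⟨y, hy⟩ := SymPower.exists_incl h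
  rw [vacuumComp, ← hy]
  refine congrArg SymPower.incl (ext_inner_right ℂ fun z => ?_)
  rw [SymPower.inner_proj_left, SymPower.inner_incl]

theorem norm_vacuum : ‖vacuum H‖ = 1 := by
  rw [vacuum, lp.norm_single (by norm_num), ← SymPower.incl.norm_map, incl_vacuumComp,
    norm_eq_sqrt_re_inner (𝕜 := ℂ), HilbertTensorPower.inner_prodVec]
  simp

instance : Nontrivial (FockSpace H) :=
  ⟨⟨vacuum H, 0, fun h => by simpa [h] using norm_vacuum (H := H)⟩⟩

/-- The total number operator `N = 0 ⊕ 1 ⊕ 2 ⊕ ⋯` with its natural domain. -/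
def number (H : Type*) [NormedAddCommGroup H] [InnerProductSpace ℂ H] :
    FockSpace H →ₗ.[ℂ] FockSpace H where
  domain :=
    { carrier := {ψ | Memℓp (fun n : ℕ => (n : ℂ) • ψ n) 2}
      add_mem' := fun {φ ψ} hφ hψ => by
        have h : (fun n : ℕ => (n : ℂ) • (φ + ψ) n) =
            (fun n : ℕ => (n : ℂ) • φ n) + fun n : ℕ => (n : ℂ) • ψ n :=
          funext fun n => smul_add _ _ _
        exact Set.mem_ofPred.2 (h.symm ▸ hφ.add hψ)
      zero_mem' := by
        have h : (fun n : ℕ => (n : ℂ) • (0 : FockSpace H) n) = 0 := funext fun n => smul_zero _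
        exact Set.mem_ofPred.2 (h.symm ▸ zero_memℓp)
      smul_mem' := fun c ψ hψ => by
        have h : (fun n : ℕ => (n : ℂ) • (c • ψ) n) = c • fun n : ℕ => (n : ℂ) • ψ n :=
          funext fun n => smul_comm (n : ℂ) c (ψ n)
        exact Set.mem_ofPred.2 (h.symm ▸ hψ.const_smul c) }
  toFun :=
    { toFun := fun ψ => ⟨fun n : ℕ => (n : ℂ) • (ψ : FockSpace H) n, ψ.2⟩
      map_add' := fun φ ψ => lp.ext (funext fun n => smul_add _ _ _)
      map_smul' := fun c ψ => lp.ext (funext fun n => smul_comm (n : ℂ) c ((ψ : FockSpace H) n)) }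

theorem function_bound {F : ℕ → ℝ} {C : ℝ} (hF : ∀ n, |F n| ≤ C) (ψ : FockSpace H) (n : ℕ) :
    ‖(F n : ℂ) • ψ n‖ ^ (2 : ℝ≥0∞).toReal ≤
      C ^ (2 : ℝ≥0∞).toReal * ‖ψ n‖ ^ (2 : ℝ≥0∞).toReal := by
  have hC : 0 ≤ C := (abs_nonneg _).trans (hF 0)
  rw [← Real.mul_rpow hC (norm_nonneg _), norm_smul, Complex.norm_real, Real.norm_eq_abs]
  gcongr
  exact hF n

/-- For `F : ℕ → ℝ` bounded by `C`, the bounded function `F(N) = F(0) ⊕ F(1) ⊕ F(2) ⊕ ⋯` of the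
total number operator `N`. -/
def functionOfNumber (F : ℕ → ℝ) (C : ℝ) (hF : ∀ n, |F n| ≤ C) : FockSpace H →L[ℂ] FockSpace H :=
  LinearMap.mkContinuous
    { toFun := fun ψ => ⟨fun n => (F n : ℂ) • ψ n,
        memℓp_gen (((lp.memℓp ψ).summable (by norm_num)).mul_left _ |>.of_nonneg_of_le
          (fun _ => by positivity) (function_bound hF ψ))⟩
      map_add' := fun φ ψ => lp.ext (funext fun n => smul_add _ _ _)
      map_smul' := fun c ψ => lp.ext (funext fun n => smul_comm (F n : ℂ) c (ψ n)) } C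
    (fun ψ => by
      have hC : 0 ≤ C := (abs_nonneg _).trans (hF 0)
      refine lp.norm_le_of_tsum_le (by norm_num) (by positivity) ?_
      have hs := ((lp.memℓp ψ).summable (by norm_num)).mul_left (C ^ (2 : ℝ≥0∞).toReal)
      refine ((hs.of_nonneg_of_le (fun _ => by positivity)
        (function_bound hF ψ)).tsum_le_tsum (function_bound hF ψ) hs).trans ?_
      rw [tsum_mul_left, Real.mul_rpow hC (norm_nonneg _), lp.norm_rpow_eq_tsum (by norm_num)])

@[simp] theorem functionOfNumber_apply (F : ℕ → ℝ) (C : ℝ) (hF : ∀ n, |F n| ≤ C) (ψ : FockSpace H)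
    (n : ℕ) : functionOfNumber F C hF ψ n = (F n : ℂ) • ψ n := rfl

/-- `F(N)` acts as multiplication by `F n` on the eigenvectors of `N` with eigenvalue `n`. -/
theorem functionOfNumber_eigenvector (F : ℕ → ℝ) (C : ℝ) (hF : ∀ n, |F n| ≤ C) (n : ℕ)
    (ψ : (number H).domain) (hψ : number H ψ = (n : ℂ) • (ψ : FockSpace H)) :
    functionOfNumber F C hF (ψ : FockSpace H) = (F n : ℂ) • (ψ : FockSpace H) := by
  refine lp.ext (funext fun m => ?_)
  have h : (m : ℂ) • (ψ : FockSpace H) m = (n : ℂ) • (ψ : FockSpace H) m :=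
    congrArg (fun χ : FockSpace H => χ m) hψ
  rw [functionOfNumber_apply, lp.coeFn_smul, Pi.smul_apply]
  by_cases hmn : m = n
  · rw [hmn]
  · have h2 : (ψ : FockSpace H) m = 0 := by
      rw [← sub_eq_zero, ← sub_smul] at h
      exact (smul_eq_zero.1 h).resolve_left (sub_ne_zero.2 (by exact_mod_cast hmn))
    rw [h2, smul_zero, smul_zero]

/-- The bounded (real) functions of the total number operator. -/
def boundedFunctionsOfNumber (H : Type*) [NormedAddCommGroup H] [InnerProductSpace ℂ H] :
    Set (FockSpace H →L[ℂ] FockSpace H) :=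
  {X | ∃ (F : ℕ → ℝ) (C : ℝ) (hF : ∀ n, |F n| ≤ C), X = functionOfNumber F C hF}

end FockSpace
end

noncomputable section

universe u

/-- A nondegenerate symplectic form on a real vector space. -/
structure SymplecticForm (S : Type u) [AddCommGroup S] [Module ℝ S] where
  /-- The underlying bilinear form. -/
  form : S →ₗ[ℝ] S →ₗ[ℝ] ℝ
  self_eq_zero : ∀ f, form f f = 0
  nondegenerate : ∀ f, (∀ g, form f g = 0) → f = 0

variable {S : Type u} [AddCommGroup S] [Module ℝ S]

theorem SymplecticForm.neg (σ : SymplecticForm S) (f g : S) : σ.form f g = -σ.form g f := by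
  have h := σ.self_eq_zero (f + g)
  simp only [map_add, LinearMap.add_apply, σ.self_eq_zero, zero_add, add_zero] at h
  linarith

/-- A complex structure on `(S, σ)`: a symplectomorphism `J` with `J ^ 2 = -1` (which makes `J`
bijective) and `σ (f, J f) > 0` for all `f ≠ 0`. -/
structure ComplexStructure (σ : SymplecticForm S) where
  /-- The underlying real-linear map. -/
  J : S →ₗ[ℝ] S
  symplectic : ∀ f g, σ.form (J f) (J g) = σ.form f g
  sq_eq_neg : ∀ f, J (J f) = -f
  pos : ∀ f, f ≠ 0 → 0 < σ.form f (J f)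

variable {σ : SymplecticForm S}

/-- The space `S` regarded as a complex pre-Hilbert space by means of a complex structure `J`. -/
def PreOneParticle (_J : ComplexStructure σ) : Type u := S

namespace PreOneParticle

variable (J : ComplexStructure σ)

instance : AddCommGroup (PreOneParticle J) := inferInstanceAs (AddCommGroup S)

/-- The identity map from `S`. -/
def mk : S →+ PreOneParticle J := AddMonoidHom.id S

variable {J} in
/-- The identity map to `S`. -/
def un : PreOneParticle J →+ S := AddMonoidHom.id S

@[simp] theorem un_mk (f : S) : un (mk J f) = f := rfl

@[simp] theorem mk_un (f : PreOneParticle J) : mk J (un f) = f := rfl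

variable {J} in
theorem ext {f g : PreOneParticle J} (h : un f = un g) : f = g := h

/-- Multiplication by complex numbers: `(a + b i) f = a f + b J f`. -/
instance : SMul ℂ (PreOneParticle J) where
  smul z f := mk J (z.re • un f + z.im • J.J (un f))

theorem un_smul (z : ℂ) (f : PreOneParticle J) :
    un (z • f) = z.re • un f + z.im • J.J (un f) := rfl

instance : Module ℂ (PreOneParticle J) where
  one_smul f := ext (by simp [un_smul])
  mul_smul z w f := ext (by
    simp only [un_smul, map_add, map_smul, J.sq_eq_neg, Complex.mul_re, Complex.mul_im]
    module)
  smul_zero z := ext (by simp [un_smul])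
  smul_add z f g := ext (by
    simp only [un_smul, map_add]
    module)
  add_smul z w f := ext (by
    simp only [un_smul, map_add, Complex.add_re, Complex.add_im]
    module)
  zero_smul f := ext (by simp [un_smul])

theorem form_J_left (f g : S) : σ.form (J.J f) g = -σ.form f (J.J g) := by
  rw [← J.symplectic f (J.J g), J.sq_eq_neg, map_neg, neg_neg]

/-- The inner product `(f, g)_J = σ (f, J g) + i σ (f, g)`. -/
instance innerCore : InnerProductSpace.Core ℂ (PreOneParticle J) where
  inner f g := ⟨σ.form (un f) (J.J (un g)), σ.form (un f) (un g)⟩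
  conj_inner_symm f g := by
    apply Complex.ext
    · change σ.form (un g) (J.J (un f)) = σ.form (un f) (J.J (un g))
      rw [σ.neg, form_J_left, neg_neg]
    · change -σ.form (un g) (un f) = σ.form (un f) (un g)
      rw [σ.neg, neg_neg]
  re_inner_nonneg f := by
    change 0 ≤ σ.form (un f) (J.J (un f))
    by_cases h : un f = 0
    · simp [h]
    · exact (J.pos _ h).le
  add_left f g h := by
    apply Complex.ext
    · change σ.form (un (f + g)) (J.J (un h)) =
        σ.form (un f) (J.J (un h)) + σ.form (un g) (J.J (un h))
      rw [map_add, map_add, LinearMap.add_apply]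
    · change σ.form (un (f + g)) (un h) = σ.form (un f) (un h) + σ.form (un g) (un h)
      rw [map_add, map_add, LinearMap.add_apply]
  smul_left f g z := by
    apply Complex.ext
    · change σ.form (un (z • f)) (J.J (un g)) =
        z.re * σ.form (un f) (J.J (un g)) - -z.im * σ.form (un f) (un g)
      rw [un_smul, map_add, map_smul, map_smul, LinearMap.add_apply, LinearMap.smul_apply,
        LinearMap.smul_apply, J.symplectic]
      simp
    · change σ.form (un (z • f)) (un g) =
        z.re * σ.form (un f) (un g) + -z.im * σ.form (un f) (J.J (un g))
      rw [un_smul, map_add, map_smul, map_smul, LinearMap.add_apply, LinearMap.smul_apply,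
        LinearMap.smul_apply, form_J_left]
      simp
  definite f h := by
    by_contra hf
    exact (J.pos (un f) hf).ne' (congrArg Complex.re h)

instance : NormedAddCommGroup (PreOneParticle J) := (innerCore J).toNormedAddCommGroup

instance : InnerProductSpace ℂ (PreOneParticle J) := InnerProductSpace.ofCore (innerCore J).toCore

theorem inner_mk (f g : S) : ⟪mk J f, mk J g⟫_ℂ = ⟨σ.form f (J.J g), σ.form f g⟩ := rfl

end PreOneParticle

/-- The one particle Hilbert space `S_J`. -/
abbrev OneParticle (J : ComplexStructure σ) : Type u := Completion (PreOneParticle J)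

namespace OneParticle

variable (J : ComplexStructure σ)

/-- The embedding of `S` into `S_J`. -/
def of (f : S) : OneParticle J := (PreOneParticle.mk J f : Completion (PreOneParticle J))

theorem of_add (f g : S) : of J (f + g) = of J f + of J g := by
  rw [of, map_add, Completion.coe_add]
  rfl

theorem of_neg (f : S) : of J (-f) = -of J f := by
  rw [of, map_neg, Completion.coe_neg]
  rfl

theorem inner_of (f g : S) : ⟪of J f, of J g⟫_ℂ = ⟨σ.form f (J.J g), σ.form f g⟩ := by
  rw [of, of, Completion.inner_coe, PreOneParticle.inner_mk]

end OneParticle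

/-- A system of Weyl operators for `(S, σ)`: unitary operators `W f`, `f ∈ S`, on a Hilbert space
that satisfy the Weyl relations. -/
structure WeylSystem (σ : SymplecticForm S) where
  /-- The Hilbert space. -/
  H : Type u
  [normed : NormedAddCommGroup H]
  [innerProduct : InnerProductSpace ℂ H]
  [complete : CompleteSpace H]
  [nontrivial : Nontrivial H]
  /-- The Weyl operators. -/
  W : S → (H →L[ℂ] H)
  unitary : ∀ f, W f ∈ unitary (H →L[ℂ] H)
  mul : ∀ f g, W f * W g = Complex.exp (-(Complex.I * σ.form f g) / 2) • W (f + g)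
  star : ∀ f, star (W f) = W (-f)

attribute [instance] WeylSystem.normed WeylSystem.innerProduct WeylSystem.complete
  WeylSystem.nontrivial

/-- The bounded families `(A_V)` of bounded operators, one on the Hilbert space of each system `V`
of Weyl operators, with the supremum norm. This is the C*-algebra of block diagonal operators on
the direct sum of all these Hilbert spaces. -/
def WeylBlocks (σ : SymplecticForm S) : Type (u + 1) :=
  lp (fun V : WeylSystem σ => V.H →L[ℂ] V.H) ∞

/-- Bounded families of elements of C*-algebras form a C*-algebra. -/
instance lpCStarAlgebra {ι : Type*} (B : ι → Type*) [∀ i, CStarAlgebra (B i)]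
    [∀ i, NormOneClass (B i)] : CStarAlgebra (lp B ∞) where
  toNormedRing := lp.inftyNormedRing
  toStarRing := lp.inftyStarRing
  toNormedAlgebra := lp.inftyNormedAlgebra
  toCompleteSpace := lp.completeSpace
  norm_mul_self_le x := CStarRing.norm_star_mul_self (x := x) |>.symm.le
  star_smul c x := lp.ext (funext fun i => star_smul c (x i))

instance (σ : SymplecticForm S) : CStarAlgebra (WeylBlocks σ) :=
  inferInstanceAs (CStarAlgebra (lp (fun V : WeylSystem σ => V.H →L[ℂ] V.H) ∞))

namespace WeylBlocks

/-- The block of a family at the system `V`. -/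
def block (V : WeylSystem σ) : WeylBlocks σ →⋆ₐ[ℂ] (V.H →L[ℂ] V.H) where
  toFun A := (show lp (fun V : WeylSystem σ => V.H →L[ℂ] V.H) ∞ from A) V
  map_one' := rfl
  map_mul' _ _ := rfl
  map_zero' := rfl
  map_add' _ _ := rfl
  commutes' _ := rfl
  map_star' _ := rfl

end WeylBlocks

/-- The Weyl operator `W(f)` of the direct sum of all systems of Weyl operators. -/
def weylGenerator (σ : SymplecticForm S) (f : S) : WeylBlocks σ :=
  ⟨fun V => V.W f, memℓp_infty ⟨1, by
    rintro _ ⟨V, rfl⟩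
    exact CStarRing.norm_of_mem_unitary (V.unitary f) |>.le⟩⟩

/-- The closed *-subalgebra generated by the Weyl operators in the direct sum of all systems of Weyl
operators. -/
def weylSubalgebra (σ : SymplecticForm S) : StarSubalgebra ℂ (WeylBlocks σ) :=
  (StarAlgebra.adjoin ℂ (Set.range (weylGenerator σ))).topologicalClosure

instance (σ : SymplecticForm S) : IsClosed (weylSubalgebra σ : Set (WeylBlocks σ)) :=
  StarSubalgebra.isClosed_topologicalClosure _

/-- The Weyl algebra over `(S, σ)`: the C*-algebra generated by the Weyl operators `W(f)`. The
Weyl operators are taken in the direct sum of all systems of Weyl operators, so that each such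
system yields a representation of the Weyl algebra; the C*-algebra generated by the Weyl operators
does not depend on the system. -/
def WeylAlgebra (σ : SymplecticForm S) : Type (u + 1) := weylSubalgebra σ

namespace WeylAlgebra

instance (σ : SymplecticForm S) : CStarAlgebra (WeylAlgebra σ) :=
  StarSubalgebra.cstarAlgebra (weylSubalgebra σ)

/-- The Weyl operators as elements of the Weyl algebra. -/
def W (σ : SymplecticForm S) (f : S) : WeylAlgebra σ :=
  ⟨weylGenerator σ f, StarSubalgebra.le_topologicalClosure _
    (StarAlgebra.subset_adjoin ℂ _ ⟨f, rfl⟩)⟩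

/-- The representation of the Weyl algebra that is given by a system of Weyl operators. -/
def rep (V : WeylSystem σ) : WeylAlgebra σ →⋆ₐ[ℂ] (V.H →L[ℂ] V.H) :=
  (WeylBlocks.block V).comp (weylSubalgebra σ).subtype

@[simp] theorem rep_W (V : WeylSystem σ) (f : S) : rep V (W σ f) = V.W f := rfl

end WeylAlgebra

/-- The Weyl operators `exp (i Φ(f))` on the Fock space over `S_J`. -/
def fockWeylSystem (J : ComplexStructure σ) : WeylSystem σ where
  H := FockSpace (OneParticle J)
  W f := FockSpace.weyl (OneParticle.of J f)
  unitary f := by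
    have h1 : ∀ g : OneParticle J, FockSpace.weyl g * FockSpace.weyl (-g) = 1 := fun g => by
      have h : (⟪g, g⟫_ℂ).im = 0 := inner_self_im (𝕜 := ℂ) g
      rw [FockSpace.weyl_mul, inner_neg_right, Complex.neg_im, h, add_neg_cancel,
        FockSpace.weyl_zero]
      simp
    rw [Unitary.mem_iff, FockSpace.adjoint_weyl]
    refine ⟨?_, h1 _⟩
    have h2 := h1 (-OneParticle.of J f)
    rwa [neg_neg] at h2
  mul f g := by
    rw [FockSpace.weyl_mul, OneParticle.inner_of, OneParticle.of_add]
  star f := by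
    rw [FockSpace.adjoint_weyl, OneParticle.of_neg]

/-- The Fock representation of the Weyl algebra, with `π(W(f)) = exp (i Φ(f))`. -/
def fockRep (J : ComplexStructure σ) :
    WeylAlgebra σ →⋆ₐ[ℂ] (FockSpace (OneParticle J) →L[ℂ] FockSpace (OneParticle J)) :=
  WeylAlgebra.rep (fockWeylSystem J)

theorem fockRep_W (J : ComplexStructure σ) (f : S) :
    fockRep J (WeylAlgebra.W σ f) = FockSpace.weyl (OneParticle.of J f) := rfl

/-- The vacuum state `ω_J(A) = ⟨Ω, π_J(A) Ω⟩`. -/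
def vacuumState (J : ComplexStructure σ) : WeylAlgebra σ →ₗ[ℂ] ℂ where
  toFun A := ⟪FockSpace.vacuum (OneParticle J), fockRep J A (FockSpace.vacuum (OneParticle J))⟫_ℂ
  map_add' A B := by
    rw [map_add]
    exact inner_add_right _ _ _
  map_smul' c A := by
    rw [map_smul]
    exact inner_smul_right _ _ _

/-- A state: a positive normalized linear functional. -/
structure IsState {A : Type*} [Ring A] [StarRing A] [Algebra ℂ A] (ρ : A →ₗ[ℂ] ℂ) : Prop where
  nonneg : ∀ a, 0 ≤ ρ (star a * a)
  normalized : ρ 1 = 1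

/-- The von Neumann algebra `π(A)''` generated by a representation `π` of `A`. -/
def bicommutant {A K : Type*} [Ring A] [StarRing A] [Algebra ℂ A] [NormedAddCommGroup K]
    [InnerProductSpace ℂ K] [CompleteSpace K] (π : A →⋆ₐ[ℂ] (K →L[ℂ] K)) :
    StarSubalgebra ℂ (K →L[ℂ] K) :=
  StarSubalgebra.centralizer ℂ
    (StarSubalgebra.centralizer ℂ (Set.range π) : Set (K →L[ℂ] K))

theorem map_mem_bicommutant {A K : Type*} [Ring A] [StarRing A] [Algebra ℂ A]
    [NormedAddCommGroup K] [InnerProductSpace ℂ K] [CompleteSpace K] (π : A →⋆ₐ[ℂ] (K →L[ℂ] K))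
    (a : A) : π a ∈ bicommutant π := by
  have h : ∀ x ∈ (StarSubalgebra.centralizer ℂ (Set.range π) : Set (K →L[ℂ] K)),
      x * π a = π a * x := fun x hx =>
    ((StarSubalgebra.mem_centralizer_iff ℂ).1 hx (π a) ⟨a, rfl⟩).1.symm
  exact (StarSubalgebra.mem_centralizer_iff ℂ).2 fun x hx => ⟨h x hx, h _ (star_mem hx)⟩

/-- A state `ρ` is dispersion-free on `X` if `ρ(X²) = ρ(X)²`. -/
def DispersionFreeOn {A : Type*} [Ring A] [Algebra ℂ A] (ρ : A →ₗ[ℂ] ℂ) (X : A) : Prop :=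
  ρ (X ^ 2) = ρ X ^ 2

/-- The state `ω` predicts dispersion in an observable `Y` that is definable in the representation
`π`, where `Y` enters through the set `B` of its bounded functions: no extension of `ω` to a state
of `π(A)''` is dispersion-free on all bounded functions of `Y`. -/
def PredictsDispersion {A K : Type*} [Ring A] [StarRing A] [Algebra ℂ A] [NormedAddCommGroup K]
    [InnerProductSpace ℂ K] [CompleteSpace K] (ω : A →ₗ[ℂ] ℂ) (π : A →⋆ₐ[ℂ] (K →L[ℂ] K))
    (B : Set (K →L[ℂ] K)) : Prop :=
  ∀ ρ : bicommutant π →ₗ[ℂ] ℂ, IsState ρ → (∀ a, ρ ⟨π a, map_mem_bicommutant π a⟩ = ω a) →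
    ¬ ∀ X : bicommutant π, (X : K →L[ℂ] K) ∈ B → DispersionFreeOn ρ X

end

/-! Suppose a state `ρ` of `π_{J₂}(𝒲)''` extends `ω_{J₁}` and is dispersion-free on all bounded
functions of `N_{J₂}`. Two of these functions already give `J₁ = J₂`: the real and imaginary parts
`cos (π N / 2)` and `sin (π N / 2)` of the unitary `i ^ N`.

By the Cauchy-Schwarz argument for `ρ`, a state that is dispersion-free on a self-adjoint `X`
satisfies `ρ (X B) = ρ X ρ B = ρ (B X)` for every `B` (`IsState.map_mul_of_dispersionFreeOn`). Hence
`ρ` is invariant under conjugation with `i ^ N`. On the Fock space over `S_{J₂}` this conjugation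
replaces `Φ(f)` by `Φ(i f)`, and multiplication by `i` is `J₂` on `S`; so it carries `π_{J₂}(W(f))`
to `π_{J₂}(W(J₂ f))` (`FockSpace.rotation_conj_weyl`). Both operators come from the Weyl algebra,
where `ρ` is `ω_{J₁}`, so `ω_{J₁}(W(J₂ f)) = ω_{J₁}(W(f))`. Since `ω_{J₁}(W(f)) = exp (-σ(f, J₁ f) /
4)` (`vacuumState_W`), the quadratic form `σ(f, J₁ f)` is invariant under `J₂`. Then `J₁` and `J₂`
commute, and positivity of both forces them to agree (`ComplexStructure.eq_of_forall_form_eq`).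

The hypothesis on `ρ` concerns only operators in the bicommutant, so the cosine and the sine must be
shown to lie there. This is irreducibility of the Fock representation
(`FockSpace.eq_smul_one_of_commute_weyl`), which rests on the expansion of the coherent vectors `exp
(i Φ(f)) Ω` in the vectors `a*(f) ^ k Ω` and on the totality of both families. -/

/-! ### Dispersion-free states -/

namespace IsState

variable {A : Type*} [Ring A] [StarRing A] [Algebra ℂ A] {ρ : A →ₗ[ℂ] ℂ}

/-- Positivity makes `ρ` real on `star (1 + X) * (1 + X) = 1 + 2 X + X * X` and on `X * X`, hence on
`X`. -/
theorem im_eq_zero_of_star_eq (hρ : IsState ρ) {X : A} (hX : star X = X) : (ρ X).im = 0 := by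
  have h1 := (Complex.nonneg_iff.1 (hρ.nonneg (1 + X))).2
  have h2 := (Complex.nonneg_iff.1 (hρ.nonneg X)).2
  rw [hX] at h2
  have h3 : star (1 + X) * (1 + X) = 1 + (2 : ℂ) • X + X * X := by
    rw [star_add, star_one, hX, two_smul]
    noncomm_ring
  rw [h3, map_add, map_add, map_smul, hρ.normalized, Complex.add_im, Complex.add_im, ← h2] at h1
  simpa using h1

variable [StarModule ℂ A]

/-- The null space of a state, by the Cauchy-Schwarz argument. -/
theorem map_mul_eq_zero (hρ : IsState ρ) {Y : A} (hY : ρ (star Y * Y) = 0) (B : A) :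
    ρ (star Y * B) = 0 ∧ ρ (star B * Y) = 0 := by
  set b := ρ (star Y * B) with hb
  set c := ρ (star B * Y) with hc
  -- Positivity at `z • Y + B`. The term quadratic in `z` drops out because `ρ (star Y * Y) = 0`,
  -- which leaves a real-affine function of `z` that is nonnegative everywhere and so must be
  -- constant.
  have key : ∀ z : ℂ, 0 ≤ starRingEnd ℂ z * b + z * c + ρ (star B * B) := fun z => by
    have h := hρ.nonneg (z • Y + B)
    have e : star (z • Y + B) * (z • Y + B) =
        (starRingEnd ℂ z * z) • (star Y * Y) + starRingEnd ℂ z • (star Y * B) +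
          z • (star B * Y) + star B * B := by
      simp only [star_add, star_smul, add_mul, mul_add, smul_mul_assoc, mul_smul_comm,
        RCLike.star_def]
      module
    rw [e] at h
    simpa [hY, ← hb, ← hc] using h
  have hK := (Complex.nonneg_iff.1 (hρ.nonneg B)).2
  have hre : ∀ x y : ℝ, 0 ≤ x * (b.re + c.re) + y * (b.im - c.im) + (ρ (star B * B)).re ∧
      0 = x * (b.im + c.im) + y * (c.re - b.re) := fun x y => by
    have h := Complex.nonneg_iff.1 (key ⟨x, y⟩)
    simp only [Complex.add_re, Complex.add_im, Complex.mul_re, Complex.mul_im, Complex.conj_re,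
      Complex.conj_im, ← hK] at h
    exact ⟨by linarith [h.1], by linarith [h.2]⟩
  set K := (ρ (star B * B)).re
  -- An affine function of nonzero slope `s` takes the value `-1` at `-(K + 1) / s`.
  have lin : ∀ s : ℝ, (∀ x : ℝ, 0 ≤ x * s + K) → s = 0 := fun s hs => by
    by_contra hne
    have := hs (-(K + 1) / s)
    rw [div_mul_cancel₀ _ hne] at this
    linarith
  have h1 := lin _ fun x => by simpa using (hre x 0).1
  have h2 := lin _ fun y => by simpa using (hre 0 y).1
  have h3 := (hre 1 0).2
  have h4 := (hre 0 1).2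
  exact ⟨Complex.ext (by simp; linarith) (by simp; linarith),
    Complex.ext (by simp; linarith) (by simp; linarith)⟩

/-- As `ρ X` is real, `Y = X - ρ X • 1` is self-adjoint, and absence of dispersion says exactly that
`ρ (star Y * Y) = 0`. So `ρ` vanishes on `Y * B` and on `B * Y`. -/
theorem map_mul_of_dispersionFreeOn (hρ : IsState ρ) {X : A} (hX : star X = X)
    (h : DispersionFreeOn ρ X) (B : A) : ρ (X * B) = ρ X * ρ B ∧ ρ (B * X) = ρ B * ρ X := by
  have hconj : starRingEnd ℂ (ρ X) = ρ X := Complex.conj_eq_iff_im.2 (hρ.im_eq_zero_of_star_eq hX)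
  have hs : star (X - ρ X • (1 : A)) = X - ρ X • 1 := by
    rw [star_sub, star_smul, star_one, hX, RCLike.star_def, hconj]
  have hY : ρ (star (X - ρ X • (1 : A)) * (X - ρ X • 1)) = 0 := by
    have h' : ρ (X * X) = ρ X * ρ X := by rw [← pow_two, ← pow_two]; exact h
    simp only [hs, sub_mul, mul_sub, map_sub, map_smul, smul_mul_assoc, mul_smul_comm, one_mul,
      mul_one, hρ.normalized, h', smul_eq_mul]
    ring
  have h1 := (hρ.map_mul_eq_zero hY B).1
  have h2 := (hρ.map_mul_eq_zero hY (star B)).2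
  rw [hs] at h1
  rw [star_star] at h2
  simp only [sub_mul, mul_sub, map_sub, map_smul, smul_mul_assoc, mul_smul_comm, one_mul,
    mul_one, smul_eq_mul, sub_eq_zero] at h1 h2
  exact ⟨h1, h2.trans (mul_comm _ _)⟩

/-- If `C + i S` is unitary and `ρ` is dispersion-free on `C` and `S`, then `ρ` is invariant under
conjugation with `C + i S`. -/
theorem map_conj_of_dispersionFreeOn (hρ : IsState ρ) {C S : A} (hC : star C = C) (hS : star S = S)
    (hCS : C * C + S * S = 1) (hc : DispersionFreeOn ρ C) (hs : DispersionFreeOn ρ S) (B : A) :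
    ρ ((C + Complex.I • S) * B * (C - Complex.I • S)) = ρ B := by
  have h1 := fun B => (hρ.map_mul_of_dispersionFreeOn hC hc B).1
  have h2 := fun B => (hρ.map_mul_of_dispersionFreeOn hC hc B).2
  have h3 := fun B => (hρ.map_mul_of_dispersionFreeOn hS hs B).1
  have h4 := fun B => (hρ.map_mul_of_dispersionFreeOn hS hs B).2
  -- The factors `C ± i S` come out of `ρ` as the numbers `ρ C ± i ρ S`, whose product is `1` by
  -- this identity.
  have h5 : ρ C * ρ C + ρ S * ρ S = 1 := by rw [← h1, ← h3, ← map_add, hCS, hρ.normalized]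
  simp only [add_mul, mul_sub, map_sub, map_add, smul_mul_assoc, mul_smul_comm, map_smul, h1, h2,
    h3, h4, smul_eq_mul]
  linear_combination ρ B * h5 - (ρ S * ρ S * ρ B) * Complex.I_mul_I

end IsState

/-! ### Rigidity of complex structures -/

theorem ComplexStructure.ext_J {S : Type*} [AddCommGroup S] [Module ℝ S] {σ : SymplecticForm S}
    {J₁ J₂ : ComplexStructure σ} (h : ∀ f, J₁.J f = J₂.J f) : J₁ = J₂ := by
  cases J₁
  cases J₂
  congr
  exact LinearMap.ext h

/-- A complex structure is determined by its invariance: if the real inner product of `J₁` is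
invariant under `J₂`, then `J₁ = J₂`. -/
theorem ComplexStructure.eq_of_forall_form_eq {S : Type*} [AddCommGroup S] [Module ℝ S]
    {σ : SymplecticForm S} {J₁ J₂ : ComplexStructure σ}
    (h : ∀ f, σ.form (J₂.J f) (J₁.J (J₂.J f)) = σ.form f (J₁.J f)) : J₁ = J₂ := by
  have symm : ∀ f g, σ.form f (J₁.J g) = σ.form g (J₁.J f) := fun f g => by
    rw [σ.neg, PreOneParticle.form_J_left, neg_neg]
  -- Polarization of the hypothesis, which concerns only the quadratic form; the bilinear form `σ
  -- (f, J₁ g)` is symmetric.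
  have polar : ∀ f g, σ.form (J₂.J f) (J₁.J (J₂.J g)) = σ.form f (J₁.J g) := fun f g => by
    have h1 := h (f + g)
    simp only [map_add, LinearMap.add_apply] at h1
    have h2 := symm f g
    have h3 := symm (J₂.J f) (J₂.J g)
    linarith [h f, h g]
  -- Moving the left `J₂` across `σ` in `polar` costs a sign, and nondegeneracy removes the test
  -- vector `f`.
  have anti : ∀ g, J₁.J g = -J₂.J (J₁.J (J₂.J g)) := fun g => by
    rw [← sub_eq_zero, sub_neg_eq_add]
    refine σ.nondegenerate _ fun f => ?_
    have h1 := polar f g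
    rw [← J₂.symplectic (J₂.J f), J₂.sq_eq_neg, map_neg, LinearMap.neg_apply] at h1
    rw [σ.neg, map_add]
    linarith
  have comm : ∀ g, J₂.J (J₁.J g) = J₁.J (J₂.J g) := fun g => by
    rw [anti g, map_neg, J₂.sq_eq_neg, neg_neg]
  refine ComplexStructure.ext_J fun g => ?_
  -- Since `J₁` and `J₂` commute, `J₁ J₂` is an involution, and `J₁ J₂ g + g` is fixed by it. On a
  -- fixed vector `J₂ = -J₁`, which the positivity of both structures excludes unless the vector is
  -- zero. So `J₁ J₂ = -1`, which gives `J₁ = J₂` after another application of `J₁`.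
  have hz : J₁.J (J₂.J g) + g = 0 := by
    by_contra hne
    have fix : J₁.J (J₂.J (J₁.J (J₂.J g) + g)) = J₁.J (J₂.J g) + g := by
      rw [map_add, map_add, comm, J₁.sq_eq_neg, J₂.sq_eq_neg, neg_neg, add_comm]
    have h2 : J₂.J (J₁.J (J₂.J g) + g) = -J₁.J (J₁.J (J₂.J g) + g) := by
      rw [← fix, J₁.sq_eq_neg, neg_neg, fix]
    have h3 := J₂.pos _ hne
    rw [h2, map_neg] at h3
    linarith [J₁.pos _ hne]
  have h4 := congrArg J₁.J (eq_neg_of_add_eq_zero_left hz)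
  rw [J₁.sq_eq_neg, map_neg, neg_inj] at h4
  exact h4.symm

/-! ### Coherent vectors: expansion and totality -/

/-- A power series that vanishes for all real arguments has vanishing coefficients. -/
theorem eq_zero_of_hasSum_mul_pow {u : ℕ → ℂ} (h : ∀ t : ℝ, HasSum (fun k => u k * (t : ℂ) ^ k) 0)
    (k : ℕ) : u k = 0 := by
  let p : FormalMultilinearSeries ℝ ℝ ℂ := fun n => ContinuousMultilinearMap.mkPiRing ℝ (Fin n) (u n)
  -- Summability at `t = 1` bounds the radius of convergence from below by `1`, so the series
  -- represents the zero function on the unit ball and uniqueness of power series applies.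
  have hs : Summable fun n => ‖u n‖ := by simpa using (h 1).summable.norm
  have hp : HasFPowerSeriesOnBall (fun _ => (0 : ℂ)) p 0 1 := by
    refine ⟨?_, one_pos, fun {y} _ => ?_⟩
    · refine p.le_radius_of_summable_norm (r := 1) (hs.congr fun n => ?_)
      simp [p]
    · refine (h y).congr_fun fun n => ?_
      simp [p, mul_comm]
  have := hp.hasFPowerSeriesAt.eq_zero
  have h2 := congrArg (fun q : FormalMultilinearSeries ℝ ℝ ℂ => q k fun _ => 1) this
  simpa [p] using h2

noncomputable section

namespace FiniteParticle

variable {H : Type*} [NormedAddCommGroup H] [InnerProductSpace ℂ H]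

/-- The vacuum as a finite particle vector. -/
def vac (H : Type*) [NormedAddCommGroup H] [InnerProductSpace ℂ H] : FiniteParticle H :=
  ⟨FockSpace.vacuum H, 1, fun n hn => lp.single_apply_ne _ _ _ (by omega)⟩

theorem toFock_vac : toFock (vac H) = FockSpace.vacuum H := rfl

theorem comp_zero_vac : comp 0 (vac H) = FockSpace.vacuumComp H :=
  lp.single_apply_self (E := fun n => SymPower H n) 2 0 (FockSpace.vacuumComp H)

theorem comp_vac_of_ne {n : ℕ} (hn : n ≠ 0) : comp n (vac H) = 0 :=
  lp.single_apply_ne (E := fun n => SymPower H n) 2 0 (FockSpace.vacuumComp H) hn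

theorem annihilation_vac (f : H) : annihilation f (vac H) = 0 := by
  refine ext fun n => ?_
  rw [comp_annihilation, comp_vac_of_ne n.succ_ne_zero, map_zero, map_zero]

theorem smul_vac_pow (c : ℂ) (f : H) (k : ℕ) (ψ : FiniteParticle H) :
    ((c • creation f) ^ k) ψ = c ^ k • (creation f ^ k) ψ := by
  rw [smul_pow, LinearMap.smul_apply]

theorem creation_smul_pow (c : ℂ) (f : H) (k : ℕ) (ψ : FiniteParticle H) :
    (creation (c • f) ^ k) ψ = c ^ k • (creation f ^ k) ψ := by
  rw [creation_smul, smul_vac_pow]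

theorem inner_vacuum_creation_pow (f : H) (k : ℕ) :
    ⟪FockSpace.vacuum H, toFock ((creation f ^ (k + 1)) (vac H))⟫_ℂ = 0 := by
  rw [← inner_conj_symm, pow_succ', Module.End.mul_apply, ← toFock_vac, inner_creation_left,
    annihilation_vac, map_zero, inner_zero_right, map_zero]

/-- The expansion of `exp (i Φ(f)) Ω` in the vectors `a*(f) ^ k Ω`. -/
theorem hasSum_inner_weyl_vacuum (φ : FockSpace H) (f : H) :
    HasSum (fun k : ℕ => (Complex.I * ((√2)⁻¹ : ℝ)) ^ k / k.factorial *
        ⟪φ, toFock ((creation f ^ k) (vac H))⟫_ℂ)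
      (Complex.exp (⟪f, f⟫_ℂ / 4) * ⟪φ, FockSpace.weyl f (FockSpace.vacuum H)⟫_ℂ) := by
  set s : ℂ := (((√2)⁻¹ : ℝ) : ℂ) with hs
  have hss : s * s = 1 / 2 := by
    rw [hs, ← Complex.ofReal_mul, ← mul_inv, Real.mul_self_sqrt (by norm_num)]
    norm_num
  set c : ℂ := ⟪f, f⟫_ℂ / 4 with hc
  set X : Module.End ℂ (FiniteParticle H) := (Complex.I * s) • creation f with hX
  set Y : Module.End ℂ (FiniteParticle H) := (Complex.I * s) • annihilation f with hY
  -- Here `i Φ(f) = X + Y` and the commutator of `X` and `Y` is the scalar `2 c = ⟪f, f⟫ / 2`. So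
  -- `exp (X + Y) exp c = exp X exp Y` degree by degree, with the annihilation operators on the
  -- right; this is where the factor `exp (⟪f, f⟫ / 4)` comes from.
  have hcomm : X * Y = Y * X + algebraMap ℂ (Module.End ℂ (FiniteParticle H)) (2 * c) := by
    refine LinearMap.ext fun ψ => ?_
    simp only [hX, hY, Module.End.mul_apply, LinearMap.smul_apply, LinearMap.add_apply, map_smul,
      annihilation_creation, Module.algebraMap_end_apply, hc]
    have : (2 : ℂ) * (⟪f, f⟫_ℂ / 4) = -((Complex.I * s) * (Complex.I * s) * ⟪f, f⟫_ℂ) := by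
      linear_combination -⟪f, f⟫_ℂ * hss + s * s * ⟪f, f⟫_ℂ * Complex.I_mul_I
    rw [this]
    module
  have hsum : X + Y = Complex.I • field f := by
    rw [hX, hY, field, smul_smul, smul_add]
  have hw : FockSpace.weyl f (FockSpace.vacuum H) = expField f (vac H) := by
    rw [← toFock_vac, FockSpace.weyl_toFock]
  have h2 : ⟪φ, expField f (vac H)⟫_ℂ = ∑' k, ⟪φ, expTerm f k (vac H)⟫_ℂ :=
    (innerSL ℂ φ).map_tsum (summable_norm_expTerm f (vac H)).of_norm
  have h3 : Summable fun k => ‖⟪φ, expTerm f k (vac H)⟫_ℂ‖ :=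
    Summable.of_nonneg_of_le (fun _ => norm_nonneg _) (fun k => norm_inner_le_norm _ _)
      ((summable_norm_expTerm f (vac H)).mul_left _)
  have hG := WeylSeries.hasSum_gaussCoeff c
  have h4 := (summable_norm_sum_mul_antidiagonal_of_summable_norm h3 hG.summable.norm).of_norm.hasSum
  rw [← tsum_mul_tsum_eq_tsum_sum_antidiagonal_of_summable_norm h3 hG.summable.norm, ← h2,
    hG.tsum_eq, mul_comm, ← hw] at h4
  refine h4.congr_fun fun k => ?_
  -- The annihilation part kills the vacuum, so only the pure creation term of each degree of `exp X
  -- exp Y` survives.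
  have hY0 : ∀ j, j ≠ 0 → (Y ^ j) (vac H) = 0 := fun j hj => by
    obtain ⟨j, rfl⟩ := Nat.exists_eq_succ_of_ne_zero hj
    rw [pow_succ, Module.End.mul_apply, hY, LinearMap.smul_apply, annihilation_vac, smul_zero,
      map_zero]
  have hP : WeylSeries.expProd X Y k (vac H) =
      ((k.factorial : ℂ)⁻¹ * (Complex.I * s) ^ k) • (creation f ^ k) (vac H) := by
    rw [WeylSeries.expProd, LinearMap.sum_apply, Finset.sum_eq_single (k, 0)]
    · rw [LinearMap.smul_apply, pow_zero, mul_one, hX, smul_vac_pow, smul_smul,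
        Nat.factorial_zero, Nat.cast_one, inv_one, mul_one]
    · rintro ⟨i, j⟩ hp hne
      have hj : j ≠ 0 := by
        rintro rfl
        exact hne (by simpa using hp)
      rw [LinearMap.smul_apply, Module.End.mul_apply, hY0 j hj, map_zero, smul_zero]
    · intro hn
      exact absurd (by simp) hn
  rw [WeylSeries.expProd_eq_expGauss hcomm, hsum, WeylSeries.expGauss, LinearMap.sum_apply] at hP
  rw [div_eq_inv_mul, ← inner_smul_right, ← map_smul, ← hP, map_sum, inner_sum]
  refine Finset.sum_congr rfl fun p _ => ?_
  rw [expTerm_apply, LinearMap.smul_apply, map_smul, inner_smul_right, inner_smul_right]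
  ring

/-- In the expansion against the vacuum itself every term with `k ≠ 0` vanishes. -/
theorem inner_vacuum_weyl_vacuum (f : H) :
    ⟪FockSpace.vacuum H, FockSpace.weyl f (FockSpace.vacuum H)⟫_ℂ =
      Complex.exp (-(⟪f, f⟫_ℂ / 4)) := by
  have h := hasSum_inner_weyl_vacuum (FockSpace.vacuum H) f
  have h1 := h.unique (hasSum_single 0 fun k hk => by
    obtain ⟨k, rfl⟩ := Nat.exists_eq_succ_of_ne_zero hk
    rw [inner_vacuum_creation_pow, mul_zero])
  have h0 : ⟪FockSpace.vacuum H, FockSpace.vacuum H⟫_ℂ = 1 := by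
    rw [inner_self_eq_norm_sq_to_K, FockSpace.norm_vacuum]
    simp
  simp only [pow_zero, Module.End.one_apply, toFock_vac, h0, Nat.factorial_zero, Nat.cast_one,
    div_one, mul_one] at h1
  rw [Complex.exp_neg]
  exact eq_inv_of_mul_eq_one_right h1

/-- Polarization: products of creation operators are determined by powers. -/
theorem map_prod_creation_eq_zero {D : Submodule ℂ H} (L : FiniteParticle H →ₗ[ℂ] ℂ)
    (hL : ∀ f ∈ D, ∀ k : ℕ, L ((creation f ^ k) (vac H)) = 0) (l : List H) (hl : ∀ f ∈ l, f ∈ D) :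
    L ((l.map creation).prod (vac H)) = 0 := by
  -- The induction removes the rightmost factor of the list, so the statement is strengthened by a
  -- power of an arbitrary `f` into which that factor can be absorbed.
  suffices h : ∀ f ∈ D, ∀ k : ℕ, L ((l.map creation).prod ((creation f ^ k) (vac H))) = 0 from
    h 0 D.zero_mem 0
  induction l using List.reverseRecOn with
  | nil => simpa using hL
  | append_singleton l g ih =>
    intro f hf m
    have hg : g ∈ D := hl g (by simp)
    have ih := ih fun f hf => hl f (by simp [hf])
    -- The coefficient of `t ^ j` in the value at `a*(t g + f) ^ (m + 1) Ω`. By the induction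
    -- hypothesis this polynomial in `t` vanishes identically, and its linear coefficient is `m + 1`
    -- times the wanted value at `a*(g) a*(f) ^ m Ω`.
    let c : ℕ → ℂ := fun j => ((m + 1).choose j : ℂ) *
      L ((l.map creation).prod ((creation g ^ j) ((creation f ^ (m + 1 - j)) (vac H))))
    have hp : ∀ t : ℂ, ∑ j ∈ Finset.range (m + 2), c j * t ^ j = 0 := fun t => by
      have h := ih (t • g + f) (D.add_mem (D.smul_mem t hg) hf) (m + 1)
      have hc : Commute (t • creation g) (creation f) :=
        LinearMap.ext fun ψ => by simp [creation_comm f g]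
      rw [creation_add, creation_smul, hc.add_pow] at h
      rw [← h]
      simp only [LinearMap.sum_apply, map_sum]
      refine Finset.sum_congr rfl fun j _ => ?_
      simp only [smul_pow, Module.End.mul_apply, LinearMap.smul_apply, c, map_smul, smul_eq_mul,
        Module.End.natCast_apply, map_nsmul, nsmul_eq_mul]
      ring
    have hq : ∑ j ∈ Finset.range (m + 2), Polynomial.monomial j (c j) = 0 :=
      Polynomial.funext fun t => by simpa [Polynomial.eval_finsetSum] using hp t
    have h1 : c 1 = 0 := by
      have := congrArg (fun q => Polynomial.coeff q 1) hq
      simpa [Polynomial.finsetSum_coeff, Polynomial.coeff_monomial] using this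
    have hm : ((m : ℂ) + 1) ≠ 0 := by exact_mod_cast m.succ_ne_zero
    simpa [c, hm] using h1

theorem comp_prod_creation_of_ne (l : List H) {n : ℕ} (hn : n ≠ l.length) :
    comp n ((l.map creation).prod (vac H)) = 0 := by
  induction l generalizing n with
  | nil => exact comp_vac_of_ne hn
  | cons g l ih =>
    rw [List.map_cons, List.prod_cons, Module.End.mul_apply]
    cases n with
    | zero => rfl
    | succ n => rw [comp_succ_creation, ih (by simpa using hn), map_zero]

/-- By adjointness, the hypothesis on `y` passes to `SymPower.annihilation f n y` for `f ∈ D`, which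
therefore vanishes by induction. So all contractions of `y` with vectors of `D` are zero, and by
density `y` is orthogonal to every product vector. -/
theorem eq_zero_of_inner_prod_creation {D : Submodule ℂ H} (hD : Dense (D : Set H)) {n : ℕ}
    (y : SymPower H n) (h : ∀ l : List H, (∀ f ∈ l, f ∈ D) → l.length = n →
      ⟪comp n ((l.map creation).prod (vac H)), y⟫_ℂ = 0) : y = 0 := by
  induction n with
  | zero =>
    refine SymPower.incl_injective (HilbertTensorPower.ext_inner_prodVec fun v => ?_)
    have := h [] (by simp) rfl
    rw [List.map_nil, List.prod_nil, Module.End.one_apply, comp_zero_vac, ← SymPower.inner_incl,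
      FockSpace.incl_vacuumComp] at this
    rw [Subsingleton.elim v Fin.elim0, this, map_zero, inner_zero_right]
  | succ n ih =>
    have h0 : ∀ f ∈ D, HilbertTensorPower.contract f (SymPower.incl y) = 0 := fun f hf => by
      have h1 : SymPower.annihilation f n y = 0 := ih _ fun l hl hlen => by
        rw [← SymPower.inner_creation_left]
        exact h (f :: l) (by simpa [hf] using hl) (by simp [hlen])
      have h2 := SymPower.incl_annihilation f y
      rw [h1, map_zero] at h2
      refine (smul_eq_zero.1 h2.symm).resolve_left ?_
      exact_mod_cast (Real.sqrt_pos.2 (by positivity : (0 : ℝ) < n + 1)).ne'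
    refine SymPower.incl_injective (HilbertTensorPower.ext_inner_prodVec fun v => ?_)
    rw [map_zero, inner_zero_right, ← Fin.cons_self_tail v, ← HilbertTensorPower.cons_prodVec]
    set x := HilbertTensorPower.prodVec (Fin.tail v)
    -- Continuity of `f ↦ f ⊗ x` allows passing from first factors in `D` to arbitrary ones.
    let K : H →L[ℂ] HilbertTensorPower H (n + 1) :=
      LinearMap.mkContinuous
        { toFun := fun f => HilbertTensorPower.cons f x
          map_add' := fun f g => HilbertTensorPower.cons_add f g x
          map_smul' := fun c f => HilbertTensorPower.cons_smul c f x } ‖x‖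
        fun f => (HilbertTensorPower.norm_cons f x).le.trans (mul_comm _ _).le
    have hcl : IsClosed {f : H | ⟪K f, SymPower.incl y⟫_ℂ = 0} :=
      isClosed_eq (by fun_prop) continuous_const
    refine hD.induction (P := fun f => ⟪K f, SymPower.incl y⟫_ℂ = 0) (fun f hf => ?_) hcl (v 0)
    change ⟪HilbertTensorPower.cons f x, SymPower.incl y⟫_ℂ = 0
    rw [← HilbertTensorPower.inner_contract_right, h0 f hf, inner_zero_right]

/-- The vectors `a*(f) ^ k Ω`, with `f` in a dense subspace, are total. -/
theorem eq_zero_of_inner_creation_pow {D : Submodule ℂ H} (hD : Dense (D : Set H))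
    (ψ : FockSpace H)
    (h : ∀ f ∈ D, ∀ k : ℕ, ⟪ψ, toFock ((creation f ^ k) (vac H))⟫_ℂ = 0) : ψ = 0 := by
  refine lp.ext (funext fun n => eq_zero_of_inner_prod_creation hD (ψ n) fun l hl hn => ?_)
  have h1 : ⟪ψ, toFock ((l.map creation).prod (vac H))⟫_ℂ = 0 :=
    map_prod_creation_eq_zero ((innerSL ℂ ψ).toLinearMap ∘ₗ toFock) h l hl
  rw [lp.inner_eq_tsum, tsum_eq_single n fun m hm => by
    rw [toFock_apply, comp_prod_creation_of_ne l (hn ▸ hm), inner_zero_right]] at h1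
  rw [← inner_conj_symm, ← toFock_apply, h1, map_zero]

end FiniteParticle
end

/-! ### Irreducibility of the Weyl operators -/

noncomputable section

namespace FockSpace

open FiniteParticle

variable {H : Type*} [NormedAddCommGroup H] [InnerProductSpace ℂ H]

/-- The coefficient of `a*(f) ^ k Ω` in the expansion of the coherent vector `exp (i Φ(f)) Ω`. -/
def coherentCoeff (k : ℕ) : ℂ := (Complex.I * ((√2)⁻¹ : ℝ)) ^ k / k.factorial

theorem coherentCoeff_ne_zero (k : ℕ) : coherentCoeff k ≠ 0 := by
  have h2 : (((√2)⁻¹ : ℝ) : ℂ) ≠ 0 := by simp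
  exact div_ne_zero (pow_ne_zero _ (mul_ne_zero Complex.I_ne_zero h2))
    (by exact_mod_cast k.factorial_ne_zero)

/-- Because `a*` is complex-linear, the coherent vectors along the complex line through `f` depend
holomorphically on `z` once the Gaussian factor is removed. -/
theorem hasSum_inner_weyl_smul_vacuum (φ : FockSpace H) (f : H) (z : ℂ) :
    HasSum (fun k : ℕ => coherentCoeff k * ⟪φ, toFock ((creation f ^ k) (vac H))⟫_ℂ * z ^ k)
      (Complex.exp (‖z • f‖ ^ 2 / 4) * ⟪φ, weyl (z • f) (vacuum H)⟫_ℂ) := by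
  have h := hasSum_inner_weyl_vacuum φ (z • f)
  rw [inner_self_eq_norm_sq_to_K] at h
  refine h.congr_fun fun k => ?_
  rw [creation_smul_pow, map_smul, inner_smul_right, coherentCoeff]
  ring

/-- Along each real line in `D` the power series above vanishes, hence so do its coefficients, and
totality of the vectors `a*(f) ^ k Ω` applies. -/
theorem eq_zero_of_inner_weyl_vacuum {D : Submodule ℂ H} (hD : Dense (D : Set H))
    (ψ : FockSpace H) (h : ∀ f ∈ D, ⟪ψ, weyl f (vacuum H)⟫_ℂ = 0) : ψ = 0 := by
  refine eq_zero_of_inner_creation_pow hD ψ fun f hf k => ?_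
  have := eq_zero_of_hasSum_mul_pow (fun t => by
    have h1 := hasSum_inner_weyl_smul_vacuum ψ f t
    rwa [h _ (D.smul_mem t hf), mul_zero] at h1) k
  exact (mul_eq_zero.1 this).resolve_left (coherentCoeff_ne_zero k)

/-- A vector `TΩ`, with `T` in the commutant of the Weyl operators, has no components with at least
one particle: its inner products with coherent vectors are both holomorphic and antiholomorphic. -/
theorem inner_commutant_creation_pow {D : Submodule ℂ H} {φ φ' : FockSpace H}
    (h : ∀ f ∈ D, ⟪φ, weyl f (vacuum H)⟫_ℂ = ⟪weyl (-f) (vacuum H), φ'⟫_ℂ)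
    {f : H} (hf : f ∈ D) {k : ℕ} (hk : k ≠ 0) :
    ⟪φ, toFock ((creation f ^ k) (vac H))⟫_ℂ = 0 := by
  let a : ℕ → ℂ := fun k => coherentCoeff k * ⟪φ, toFock ((creation f ^ k) (vac H))⟫_ℂ
  let b : ℕ → ℂ := fun k => starRingEnd ℂ
    (coherentCoeff k * ⟪φ', toFock ((creation f ^ k) (vac H))⟫_ℂ * (-1) ^ k)
  -- The hypothesis equates a power series in `w` with one in the conjugate of `w`: the Gaussian
  -- factors at `w • f` and `-w • f` agree. Replacing `w` by `t * w` with `t` real and comparing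
  -- powers of `t` separates the degrees.
  have key : ∀ w : ℂ, ∀ k, a k * w ^ k = b k * starRingEnd ℂ w ^ k := fun w k => by
    rw [← sub_eq_zero]
    refine eq_zero_of_hasSum_mul_pow (u := fun k => a k * w ^ k - b k * starRingEnd ℂ w ^ k)
      (fun t => ?_) k
    have h1 := hasSum_inner_weyl_smul_vacuum φ f (t * w)
    have h2 := (hasSum_inner_weyl_smul_vacuum φ' f (-(t * w))).map (starRingEnd ℂ)
      Complex.continuous_conj
    have e : starRingEnd ℂ (Complex.exp ((‖-(t * w) • f‖ : ℂ) ^ 2 / 4) *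
        ⟪φ', weyl (-(t * w) • f) (vacuum H)⟫_ℂ) =
        Complex.exp ((‖(t * w) • f‖ : ℂ) ^ 2 / 4) * ⟪φ, weyl ((t * w) • f) (vacuum H)⟫_ℂ := by
      rw [map_mul, inner_conj_symm, neg_smul, norm_neg, ← h _ (D.smul_mem _ hf), ← Complex.exp_conj]
      simp [map_ofNat (starRingEnd ℂ) 4]
    rw [e] at h2
    have h3 := h1.sub h2
    rw [sub_self] at h3
    refine h3.congr_fun fun k => ?_
    simp only [a, b, Function.comp_apply, map_mul, map_pow, map_neg, map_one, Complex.conj_ofReal,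
      neg_pow (_ * _ : ℂ)]
    ring
  have hab : a k = b k := by simpa using key 1 k
  -- At `w = 1` the two coefficients agree; at a `k`-th root of `i`, which needs `k ≠ 0`, they
  -- satisfy `a k * i = -(b k * i)`. So `a k = 0`.
  obtain ⟨w, hw⟩ := IsAlgClosed.exists_pow_nat_eq Complex.I (Nat.pos_of_ne_zero hk)
  have h1 := key w k
  rw [← map_pow, hw, Complex.conj_I, ← hab] at h1
  have h2 : a k * (2 * Complex.I) = 0 := by linear_combination h1
  exact (mul_eq_zero.1 ((mul_eq_zero.1 h2).resolve_right (by simp))).resolve_left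
    (coherentCoeff_ne_zero k)

/-- Irreducibility of the Weyl operators on the Fock space. -/
theorem eq_smul_one_of_commute_weyl {D : Submodule ℂ H} (hD : Dense (D : Set H))
    {T : FockSpace H →L[ℂ] FockSpace H} (hT : ∀ f ∈ D, T * weyl f = weyl f * T) :
    ∃ c : ℂ, T = c • 1 := by
  have h0 : ⟪vacuum H, vacuum H⟫_ℂ = 1 := by
    rw [inner_self_eq_norm_sq_to_K, norm_vacuum]
    simp
  have hadj : ∀ (f : H) (φ ψ : FockSpace H), ⟪φ, weyl f ψ⟫_ℂ = ⟪weyl (-f) φ, ψ⟫_ℂ :=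
    fun f φ ψ => by
      rw [← adjoint_weyl, ContinuousLinearMap.star_eq_adjoint,
        ContinuousLinearMap.adjoint_inner_left]
  have hTw : ∀ f ∈ D, ∀ ψ, T (weyl f ψ) = weyl f (T ψ) := fun f hf ψ =>
    congrArg (fun L => L ψ) (hT f hf)
  set c := ⟪vacuum H, T (vacuum H)⟫_ℂ with hc
  -- The vacuum is an eigenvector of `T`: the difference is tested against the total family `a*(f) ^
  -- k Ω`, where `c` is chosen to settle `k = 0`.
  have hvac : T (vacuum H) = c • vacuum H := by
    rw [← sub_eq_zero]
    refine eq_zero_of_inner_creation_pow hD _ fun f hf k => ?_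
    rw [inner_sub_left, inner_smul_left]
    cases k with
    | zero =>
      rw [pow_zero, Module.End.one_apply, toFock_vac, h0, hc, inner_conj_symm, mul_one, sub_self]
    | succ k =>
      rw [inner_vacuum_creation_pow, mul_zero, sub_zero]
      -- With `φ = T Ω` and `φ' = T* Ω`, the required identity is commutation of `T` with `W(-g)`,
      -- combined with `W(g)* = W(-g)`.
      refine inner_commutant_creation_pow (D := D) (φ' := ContinuousLinearMap.adjoint T (vacuum H))
        (fun g hg => ?_) hf k.succ_ne_zero
      rw [ContinuousLinearMap.adjoint_inner_right, hTw _ (D.neg_mem hg), hadj]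
  refine ⟨c, ?_⟩
  have hcoh : ∀ f ∈ D, T (weyl f (vacuum H)) = c • weyl f (vacuum H) := fun f hf => by
    rw [hTw f hf, hvac, map_smul]
  refine ContinuousLinearMap.ext fun ψ => ext_inner_left ℂ fun χ => ?_
  -- Now `T` acts as `c` on all coherent vectors; their totality is used through the adjoint, as an
  -- orthogonality statement.
  have hz : ContinuousLinearMap.adjoint T χ - starRingEnd ℂ c • χ = 0 :=
    eq_zero_of_inner_weyl_vacuum hD _ fun f hf => by
      rw [inner_sub_left, inner_smul_left, ContinuousLinearMap.adjoint_inner_left, hcoh f hf,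
        inner_smul_right, Complex.conj_conj, sub_self]
  rw [← ContinuousLinearMap.adjoint_inner_left, sub_eq_zero.1 hz, inner_smul_left,
    Complex.conj_conj, smul_apply, inner_smul_right, one_apply_eq_self]

/-! ### The unitary `i ^ N` and its action on Weyl operators -/

theorem star_functionOfNumber (F : ℕ → ℝ) (C : ℝ) (hF : ∀ n, |F n| ≤ C) :
    star (functionOfNumber F C hF : FockSpace H →L[ℂ] FockSpace H) = functionOfNumber F C hF := by
  rw [ContinuousLinearMap.star_eq_adjoint]
  refine ((ContinuousLinearMap.eq_adjoint_iff _ _).2 fun φ ψ => ?_).symm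
  rw [lp.inner_eq_tsum, lp.inner_eq_tsum]
  refine tsum_congr fun n => ?_
  rw [functionOfNumber_apply, functionOfNumber_apply, inner_smul_left, inner_smul_right,
    Complex.conj_ofReal]

/-- `cos (π N / 2)`. -/
def cosNumber (H : Type*) [NormedAddCommGroup H] [InnerProductSpace ℂ H] :
    FockSpace H →L[ℂ] FockSpace H :=
  functionOfNumber (fun n => (Complex.I ^ n).re) 1 fun n =>
    (Complex.abs_re_le_norm _).trans (by simp)

/-- `sin (π N / 2)`. -/
def sinNumber (H : Type*) [NormedAddCommGroup H] [InnerProductSpace ℂ H] :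
    FockSpace H →L[ℂ] FockSpace H :=
  functionOfNumber (fun n => (Complex.I ^ n).im) 1 fun n =>
    (Complex.abs_im_le_norm _).trans (by simp)

theorem star_cosNumber : star (cosNumber H) = cosNumber H := star_functionOfNumber _ _ _

theorem star_sinNumber : star (sinNumber H) = sinNumber H := star_functionOfNumber _ _ _

theorem cosNumber_mem : cosNumber H ∈ boundedFunctionsOfNumber H := ⟨_, _, _, by rw [cosNumber]⟩

theorem sinNumber_mem : sinNumber H ∈ boundedFunctionsOfNumber H := ⟨_, _, _, by rw [sinNumber]⟩

theorem cosNumber_sq_add_sinNumber_sq :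
    cosNumber H * cosNumber H + sinNumber H * sinNumber H = 1 := by
  refine ContinuousLinearMap.ext fun ψ => lp.ext (funext fun n => ?_)
  change (((Complex.I ^ n).re : ℝ) : ℂ) • (((Complex.I ^ n).re : ℝ) : ℂ) • ψ n +
    (((Complex.I ^ n).im : ℝ) : ℂ) • (((Complex.I ^ n).im : ℝ) : ℂ) • ψ n = ψ n
  have h : ((Complex.I ^ n).re : ℂ) * (Complex.I ^ n).re +
      ((Complex.I ^ n).im : ℂ) * (Complex.I ^ n).im = 1 := by
    have := Complex.normSq_apply (Complex.I ^ n)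
    rw [map_pow, Complex.normSq_I, one_pow] at this
    exact_mod_cast this.symm
  rw [smul_smul, smul_smul, ← add_smul, h, one_smul]

/-- `i ^ N`. -/
def rotation (H : Type*) [NormedAddCommGroup H] [InnerProductSpace ℂ H] :
    FockSpace H →L[ℂ] FockSpace H :=
  cosNumber H + Complex.I • sinNumber H

theorem rotation_apply (ψ : FockSpace H) (n : ℕ) : rotation H ψ n = Complex.I ^ n • ψ n := by
  change (((Complex.I ^ n).re : ℝ) : ℂ) • ψ n +
    Complex.I • (((Complex.I ^ n).im : ℝ) : ℂ) • ψ n = _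
  rw [smul_smul, ← add_smul, mul_comm, Complex.re_add_im]

/-- `i ^ N` on finite particle vectors. -/
def finRotation (ψ : FiniteParticle H) : FiniteParticle H :=
  FiniteParticle.mk (fun n => Complex.I ^ n • comp n ψ) (by
    obtain ⟨N, hN⟩ := exists_bound ψ
    exact ⟨N, fun n hn => by rw [hN n hn, smul_zero]⟩)

theorem rotation_toFock (ψ : FiniteParticle H) : rotation H (toFock ψ) = toFock (finRotation ψ) :=
  lp.ext (funext fun n => rotation_apply _ n)

/-- Creation raises the particle number and, being linear in `f`, supplies the additional factor
`i`. Annihilation lowers the number and is conjugate-linear in `f`, and the conjugate of `i` cancels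
the surplus factor. -/
theorem finRotation_field (f : H) (ψ : FiniteParticle H) :
    finRotation (field f ψ) = field (Complex.I • f) (finRotation ψ) := by
  refine FiniteParticle.ext fun n => ?_
  simp only [finRotation, comp_mk, field, LinearMap.smul_apply, LinearMap.add_apply, map_smul,
    map_add, comp_annihilation, SymPower.annihilation_smul, creation_smul]
  have e : starRingEnd ℂ Complex.I * Complex.I ^ (n + 1) = Complex.I ^ n := by
    rw [Complex.conj_I, pow_succ]
    linear_combination -Complex.I ^ n * Complex.I_mul_I
  rw [smul_comm, smul_add, smul_smul (Complex.I ^ (n + 1)), mul_comm (Complex.I ^ (n + 1)), e]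
  cases n with
  | zero => simp
  | succ n =>
    rw [comp_succ_creation, comp_succ_creation, comp_mk, map_smul, smul_smul Complex.I, ← pow_succ']

theorem rotation_expTerm (f : H) (k : ℕ) (ψ : FiniteParticle H) :
    rotation H (expTerm f k ψ) = expTerm (Complex.I • f) k (finRotation ψ) := by
  have h : ∀ k : ℕ, finRotation ((field f ^ k) ψ) =
      (field (Complex.I • f) ^ k) (finRotation ψ) := fun k => by
    induction k with
    | zero => rfl
    | succ k ih =>
      rw [pow_succ', pow_succ', Module.End.mul_apply, Module.End.mul_apply, finRotation_field, ih]
  rw [expTerm_apply, expTerm_apply, smul_pow, smul_pow, LinearMap.smul_apply, LinearMap.smul_apply,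
    map_smul, map_smul, map_smul, map_smul, rotation_toFock, h]

/-- The intertwining of the field operators passes to each term of the exponential series, then to
the sum by continuity, and to all vectors by density. -/
theorem rotation_mul_weyl (f : H) :
    rotation H * weyl f = weyl (Complex.I • f) * rotation H := by
  refine ContinuousLinearMap.ext fun ψ => ?_
  refine denseRange_toFock.induction_on ψ (isClosed_eq (by fun_prop) (by fun_prop)) fun ψ => ?_
  rw [mul_apply_eq_comp, mul_apply_eq_comp, rotation_toFock, weyl_toFock, weyl_toFock]
  refine ((rotation H).hasSum (hasSum_expField f ψ)).unique ?_
  simpa only [rotation_expTerm] using hasSum_expField (Complex.I • f) (finRotation ψ)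

theorem rotation_mul_conj :
    rotation H * (cosNumber H - Complex.I • sinNumber H) = 1 := by
  have hcomm : cosNumber H * sinNumber H = sinNumber H * cosNumber H :=
    ContinuousLinearMap.ext fun ψ => lp.ext (funext fun n => smul_comm _ _ (ψ n))
  rw [rotation, ← cosNumber_sq_add_sinNumber_sq]
  simp only [add_mul, mul_sub, smul_add, mul_smul_comm, smul_mul_assoc, smul_smul,
    Complex.I_mul_I, hcomm]
  module

theorem rotation_conj_weyl (f : H) :
    rotation H * weyl f * (cosNumber H - Complex.I • sinNumber H) = weyl (Complex.I • f) := by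
  rw [rotation_mul_weyl, mul_assoc, rotation_mul_conj, mul_one]

end FockSpace

/-! ### The Fock representations and the conclusion -/

variable {S : Type*} [AddCommGroup S] [Module ℝ S] {σ : SymplecticForm S}

namespace OneParticle

theorem of_J (J : ComplexStructure σ) (f : S) : of J (J.J f) = Complex.I • of J f := by
  rw [of, of, ← Completion.coe_smul]
  congr 1
  exact PreOneParticle.ext (by simp [PreOneParticle.un_smul])

/-- The Weyl algebra provides Weyl operators only for vectors of `S`, not of its completion. This is
why irreducibility is proved with a dense complex subspace `D`. -/
theorem exists_dense_submodule (J : ComplexStructure σ) :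
    ∃ D : Submodule ℂ (OneParticle J), Dense (D : Set (OneParticle J)) ∧
      ∀ x ∈ D, ∃ f : S, x = of J f := by
  refine ⟨LinearMap.range (Completion.toComplₗᵢ (𝕜 := ℂ) (E := PreOneParticle J)).toLinearMap,
    ?_, ?_⟩
  · exact Completion.denseRange_coe
  · rintro _ ⟨f, rfl⟩
    exact ⟨PreOneParticle.un f, rfl⟩

end OneParticle

/-- By irreducibility the commutant consists of scalars, so every bounded operator, in particular
every bounded function of the number operator, lies in the von Neumann algebra on which the extended
state is defined. -/
theorem mem_bicommutant_fockRep (J : ComplexStructure σ)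
    (X : FockSpace (OneParticle J) →L[ℂ] FockSpace (OneParticle J)) :
    X ∈ bicommutant (fockRep J) := by
  obtain ⟨D, hD, hof⟩ := OneParticle.exists_dense_submodule J
  have key : ∀ T ∈ StarSubalgebra.centralizer ℂ (Set.range (fockRep J)), T * X = X * T := by
    intro T hT
    obtain ⟨c, rfl⟩ := FockSpace.eq_smul_one_of_commute_weyl hD (T := T) fun x hx => by
      obtain ⟨f, rfl⟩ := hof x hx
      exact ((StarSubalgebra.mem_centralizer_iff ℂ).1 hT _ ⟨WeylAlgebra.W σ f, rfl⟩).1.symm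
    rw [smul_one_mul, mul_smul_comm, mul_one]
  exact (StarSubalgebra.mem_centralizer_iff ℂ).2 fun T hT => ⟨key T hT, key _ (star_mem hT)⟩

theorem vacuumState_W (J : ComplexStructure σ) (f : S) :
    vacuumState J (WeylAlgebra.W σ f) = Complex.exp (-((σ.form f (J.J f) : ℝ) / 4 : ℂ)) := by
  refine (FiniteParticle.inner_vacuum_weyl_vacuum (OneParticle.of J f)).trans ?_
  have : (⟨σ.form f (J.J f), 0⟩ : ℂ) = (σ.form f (J.J f) : ℝ) := rfl
  rw [OneParticle.inner_of, σ.self_eq_zero, this]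

theorem predictsDispersion_number {J₁ J₂ : ComplexStructure σ} (hJ : J₁ ≠ J₂) :
    PredictsDispersion (vacuumState J₁) (fockRep J₂)
      (FockSpace.boundedFunctionsOfNumber (OneParticle J₂)) := by
  intro ρ hρ hext hdf
  refine hJ (ComplexStructure.eq_of_forall_form_eq fun f => ?_)
  let C : bicommutant (fockRep J₂) := ⟨FockSpace.cosNumber _, mem_bicommutant_fockRep J₂ _⟩
  let Sn : bicommutant (fockRep J₂) := ⟨FockSpace.sinNumber _, mem_bicommutant_fockRep J₂ _⟩
  have h := hρ.map_conj_of_dispersionFreeOn (C := C) (S := Sn)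
    (Subtype.ext FockSpace.star_cosNumber) (Subtype.ext FockSpace.star_sinNumber)
    (Subtype.ext FockSpace.cosNumber_sq_add_sinNumber_sq)
    (hdf C FockSpace.cosNumber_mem) (hdf Sn FockSpace.sinNumber_mem)
    ⟨fockRep J₂ (WeylAlgebra.W σ f), map_mem_bicommutant _ _⟩
  -- Multiplication by `i` on the one-particle space is `J₂` on `S`, so the conjugated Weyl operator
  -- again comes from the Weyl algebra, where `ρ` is known.
  have e : (C + Complex.I • Sn) * ⟨fockRep J₂ (WeylAlgebra.W σ f), map_mem_bicommutant _ _⟩ *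
      (C - Complex.I • Sn) =
      ⟨fockRep J₂ (WeylAlgebra.W σ (J₂.J f)), map_mem_bicommutant _ _⟩ := by
    refine Subtype.ext ((FockSpace.rotation_conj_weyl (OneParticle.of J₂ f)).trans ?_)
    rw [← OneParticle.of_J]
    rfl
  rw [e, hext, hext, vacuumState_W, vacuumState_W] at h
  -- Both exponents are real, and the real exponential, unlike the complex one, is injective.
  have h' : Real.exp (-(σ.form (J₂.J f) (J₁.J (J₂.J f)) / 4)) =
      Real.exp (-(σ.form f (J₁.J f) / 4)) := by exact_mod_cast h
  linarith [Real.exp_injective h']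

end

/-- If `J₁` and `J₂` are distinct complex structures on `(S, σ)`, then the vacuum state of `J₁`
predicts dispersion in the total number operator of `J₂`, and vice versa. -/
theorem proposition9 {S : Type*} [AddCommGroup S] [Module ℝ S] (σ : SymplecticForm S)
    (J₁ J₂ : ComplexStructure σ) (hJ : J₁ ≠ J₂) :
    PredictsDispersion (vacuumState J₁) (fockRep J₂)
        (FockSpace.boundedFunctionsOfNumber (OneParticle J₂)) ∧
      PredictsDispersion (vacuumState J₂) (fockRep J₁)
        (FockSpace.boundedFunctionsOfNumber (OneParticle J₁)) :=
  ⟨predictsDispersion_number hJ, predictsDispersion_number hJ.symm⟩
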